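/- **The random graph.** For real $\delta\ge 0$, $\mathrm{PA}_1(1,\delta)$ is a single vertex with one loop. Given $\mathrm{PA}_n(1,\delta)$, the graph $\mathrm{PA}_{n+1}(1,\delta)$ is obtained by adding a vertex $n+1$ with one edge, whose other end is $n+1$ itself with probability $\frac{1+\delta}{n(2+\delta)+(1+\delta)}$ and is $i\in\{1,\dots,n\}$ with probability $\frac{D_i(n)+\delta}{n(2+\delta)+(1+\delta)}$, where $D_i(n)$ is the degree of $i$ in $\mathrm{PA}_n(1,\delta)$ (loops count twice). For $m\ge 1$, $\mathrm{PA}_t(m,\delta)$ is the multigraph on $\{1,\dots,t\}$ obtained from $\mathrm{PA}_{mt}(1,\delta/m)$ by contracting, for each $i=1,\dots,t$, the vertices $(i-1)m+1,\dots,im$ into the vertex $i$, keeping all loops and multiple edges. **The protocol.** Let $k$ be odd. In the $k$-choice local majority protocol $\mathcal{MP}^k$ on a multigraph whose vertices are coloured red or blue at time $0$, at each time step $\tau=1,2,\dots$ each vertex $v$, independently of everything else, chooses uniformly at random a set of $k$ of its neighbours, counted with multiplicity (that is, a set of $k$ of the half-edges at $v$, a loop giving two half-edges); if the degree of $v$ is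 less than $k$, it chooses uniformly at random such a set of the largest possible odd cardinality. The colour of $v$ at time $\tau$ is the majority colour, at time $\tau-1$, of the chosen neighbours. **Theorem.** Let $k\ge 5$ be odd, let $m\ge 5$, and let $d=\min(m,k)$ if $m$ is odd and $d=\min(m-1,k)$ if $m$ is even. Let $\alpha^*$ be the smallest positive solution $x\in(0,1]$ of the equation $$\Pr\Big(\mathrm{Bin}(d-1,x)\ge \tfrac{d-1}{2}\Big)=x .$$ Let $\delta\ge 0$ and $0\le\alpha<\alpha^*$, and suppose that, given $\mathrm{PA}_t(m,\delta)$, each of its vertices is coloured red at time $0$ independently with probability $\alpha$, and blue otherwise. Then for every constant $\varepsilon>0$, with probability tending to $1$ as $t\to\infty$ (with $m,k,\delta,\alpha,\varepsilon$ fixed), under $\mathcal{MP}^k$ every vertex of $\mathrm{PA}_t(m,\delta)$ is blue at all time steps $$\tau\ \ge\ \frac{1+\varepsilon}{\log_d\big(\frac{d-1}{2}\big)}\,\log_d\log_d t .$$ -/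

import Mathlib

open MeasureTheory ProbabilityTheory Filter Topology
open scoped NNReal ENNReal

namespace PrefAttach

/-! ### Finite multigraphs -/

/-- A multigraph with vertex set `V` and edge set `E`; loops and parallel edges are allowed.
The edge `e` consists of the two half-edges `(e, false)` and `(e, true)`, and `G.ends e b` is the
vertex at which the half-edge `(e, b)` sits. -/
structure Multigraph (V E : Type) where
  ends : E → Bool → V

namespace Multigraph

variable {V W E : Type}

/-- The vertex at which a half-edge sits. -/
def base (G : Multigraph V E) (h : E × Bool) : V := G.ends h.1 h.2

/-- The vertex at the other end of the edge to which a half-edge belongs. -/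
def opposite (G : Multigraph V E) (h : E × Bool) : V := G.ends h.1 (!h.2)

/-- The image of a multigraph under a map of vertices; all loops and parallel edges that this
creates are kept. -/
def contract (G : Multigraph V E) (f : V → W) : Multigraph W E where
  ends e b := f (G.ends e b)

/-- The half-edges that sit at `v`; a loop at `v` contributes both of its half-edges. -/
def halfEdges [Fintype E] [DecidableEq V] (G : Multigraph V E) (v : V) : Finset (E × Bool) :=
  Finset.univ.filter fun h => G.base h = v

/-- The degree of `v`; loops count twice. -/
def degree [Fintype E] [DecidableEq V] (G : Multigraph V E) (v : V) : ℕ :=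
  (G.halfEdges v).card

lemma sum_degree [Fintype V] [Fintype E] [DecidableEq V] (G : Multigraph V E) :
    ∑ v, G.degree v = 2 * Fintype.card E := by
  have h := Finset.card_eq_sum_card_fiberwise (s := (Finset.univ : Finset (E × Bool)))
    (t := (Finset.univ : Finset V)) (f := G.base) (fun _ _ => by simp)
  simp only [degree, halfEdges]
  rw [← h, Finset.card_univ, Fintype.card_prod, Fintype.card_bool, mul_comm]

end Multigraph

/-! ### Preferential attachment -/

/-- The possible outcomes of `PA_n(1, δ)`, with vertices numbered from `0`: vertex `i` has one edge
of its own, whose other end is one of the vertices `0, …, i`. -/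
abbrev Attachments (n : ℕ) : Type := (i : Fin n) → Fin ((i : ℕ) + 1)

/-- The graph in which the edge `i` joins the vertex `i` to the vertex `g i`. -/
def attachmentGraph {n : ℕ} (g : Attachments n) : Multigraph (Fin n) (Fin n) where
  ends i b := if b then ⟨g i, by have := (g i).isLt; have := i.isLt; omega⟩ else i

/-- `g` followed by the choice `x` of the vertex `n`. -/
def Attachments.extend {n : ℕ} (g : Attachments n) (x : Fin (n + 1)) : Attachments (n + 1) :=
  Fin.snoc (α := fun i : Fin (n + 1) => Fin ((i : ℕ) + 1)) g x

/-- The probability that the edge of the new vertex `n` connects to `i`, given the graph on the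
vertices `0, …, n - 1`: it is `(1 + δ) / (n (2 + δ) + (1 + δ))` for the new vertex itself and
`(D_i(n) + δ) / (n (2 + δ) + (1 + δ))` for an old vertex `i`. -/
noncomputable def stepProb (δ : ℝ≥0) {n : ℕ} (g : Attachments n) (i : Fin (n + 1)) : ℝ≥0 :=
  Fin.lastCases (motive := fun _ => ℝ≥0)
    ((1 + δ) / (n * (2 + δ) + (1 + δ)))
    (fun j => ((attachmentGraph g).degree j + δ) / (n * (2 + δ) + (1 + δ))) i

lemma sum_stepProb (δ : ℝ≥0) {n : ℕ} (g : Attachments n) : ∑ i, stepProb δ g i = 1 := by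
  have h : ∑ j, (((attachmentGraph g).degree j : ℕ) : ℝ≥0) = 2 * n := by
    have := (attachmentGraph g).sum_degree
    rw [Fintype.card_fin] at this
    exact_mod_cast this
  rw [Fin.sum_univ_castSucc]
  simp only [stepProb, Fin.lastCases_castSucc, Fin.lastCases_last]
  rw [← Finset.sum_div, ← add_div, Finset.sum_add_distrib, h]
  simp only [Finset.sum_const, Finset.card_univ, Fintype.card_fin, nsmul_eq_mul]
  rw [div_eq_one_iff_eq (by positivity)]
  ring

/-- The law of the end of the edge of the new vertex. -/
noncomputable def stepLaw (δ : ℝ≥0) {n : ℕ} (g : Attachments n) : PMF (Fin (n + 1)) :=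
  PMF.ofFintype (fun i => (stepProb δ g i : ℝ≥0∞)) (by
    rw [← ENNReal.ofNNReal_finsetSum, sum_stepProb, ENNReal.coe_one])

/-- The law of `PA_n(1, δ)`. The growth rule applied to the empty graph produces the vertex `0` with
a loop, with probability one, so that `PA_1(1, δ)` is a single vertex with a loop. -/
noncomputable def attachmentLaw (δ : ℝ≥0) : (n : ℕ) → PMF (Attachments n)
  | 0 => PMF.pure fun i => i.elim0
  | n + 1 => (attachmentLaw δ n).bind fun g => (stepLaw δ g).map g.extend

/-- The graph obtained from an outcome of `PA_{tm}(1, ·)` by contracting, for each `i < t`, the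
vertices `i m, …, i m + m - 1` into the vertex `i`. If the outcome has the law
`attachmentLaw (δ / m) (t * m)`, then this is the random graph `PA_t(m, δ)`. -/
def paGraph (m t : ℕ) (g : Attachments (t * m)) : Multigraph (Fin t) (Fin (t * m)) :=
  (attachmentGraph g).contract Fin.divNat

/-! ### The `k`-choice local majority protocol -/

inductive Colour
  | red
  | blue
  deriving DecidableEq

instance : MeasurableSpace Colour := ⊤

section Protocol

variable {V E : Type} [Fintype V] [DecidableEq V] [Fintype E]

/-- The number of neighbours that a vertex of degree `D` polls: `k` if `k ≤ D`, and otherwise the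
largest odd number that is at most `D` (or none if `D = 0`). -/
def pollSize (k D : ℕ) : ℕ :=
  if k ≤ D then k else if Odd D then D else D - 1

lemma pollSize_le (k D : ℕ) : pollSize k D ≤ D := by
  unfold pollSize
  split_ifs <;> omega

/-- The law of one poll of `v`: a set of half-edges at `v` of the prescribed size, chosen uniformly
at random. Thus neighbours are counted with multiplicity. -/
noncomputable def pollLaw (G : Multigraph V E) (k : ℕ) (v : V) : PMF (Finset (E × Bool)) :=
  PMF.uniformOfFinset ((G.halfEdges v).powersetCard (pollSize k (G.degree v)))
    (Finset.powersetCard_nonempty.2 (pollSize_le k (G.degree v)))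

/-- The colours at time `τ`, given the initial colours `c` and the polls; `polls (τ, v)` is the
poll of `v` that determines its colour at time `τ + 1`. -/
def colourAt (G : Multigraph V E) (c : V → Colour) (polls : ℕ × V → Finset (E × Bool)) :
    ℕ → V → Colour
  | 0 => c
  | τ + 1 => fun v =>
      if (polls (τ, v)).card <
          2 * ((polls (τ, v)).filter fun h => colourAt G c polls τ (G.opposite h) = .red).card
      then .red else .blue

/-- The joint law of the initial colours and of all polls, on a fixed multigraph: all of these are
independent, and every vertex is initially red with probability `α`. -/
noncomputable def protocolLaw (G : Multigraph V E) (k : ℕ) (α : unitInterval) :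
    Measure ((V → Colour) × (ℕ × V → Finset (E × Bool))) :=
  (Measure.pi fun _ : V => bernoulliMeasure Colour.red Colour.blue α).prod
    (Measure.infinitePi fun i : ℕ × V => (pollLaw G k i.2).toMeasure)

instance (G : Multigraph V E) (k : ℕ) (α : unitInterval) :
    IsProbabilityMeasure (protocolLaw G k α) := by
  unfold protocolLaw
  infer_instance

end Protocol

/-! ### The protocol on the preferential attachment graph -/

/-- An outcome of the whole experiment: the random graph, the initial colours and the polls. -/
abbrev Outcome (m t : ℕ) : Type :=
  Attachments (t * m) × (Fin t → Colour) × (ℕ × Fin t → Finset (Fin (t * m) × Bool))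

/-- The law of the experiment: first `PA_t(m, δ)` is generated, and then, given the graph, the
protocol is run with initial density `α` of red vertices. -/
noncomputable def experimentLaw (m : ℕ) (δ : ℝ≥0) (k : ℕ) (α : unitInterval) (t : ℕ) :
    Measure (Outcome m t) :=
  (attachmentLaw (δ / m) (t * m)).toMeasure ⊗ₘ
    Kernel.ofFunOfCountable fun g => protocolLaw (paGraph m t g) k α

instance (m : ℕ) (δ : ℝ≥0) (k : ℕ) (α : unitInterval) (t : ℕ) :
    IsProbabilityMeasure (experimentLaw m δ k α t) := by
  have : IsMarkovKernel (Kernel.ofFunOfCountable fun g : Attachments (t * m) =>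
      protocolLaw (paGraph m t g) k α) :=
    ⟨fun g => inferInstanceAs (IsProbabilityMeasure (protocolLaw (paGraph m t g) k α))⟩
  unfold experimentLaw
  infer_instance

/-- The colour of the vertex `v` at time `τ` in a given outcome. -/
def Outcome.colour {m t : ℕ} (ω : Outcome m t) (τ : ℕ) (v : Fin t) : Colour :=
  colourAt (paGraph m t ω.1) ω.2.1 ω.2.2 τ v

end PrefAttach

set_option linter.unusedSectionVars false

/-! Write d = 2r + 1 and f(x) = Pr(Bin(2r, x) ≥ r), and let `redBound` be the orbit of α under f.
Since α lies below the smallest positive fixed point of f, the orbit tends to 0. Near 0 the map is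
bounded by a constant times x ^ r with r ≥ 2, so the decay is doubly exponential
(`exists_redBound_le_exp`), and (1 + ε) log_r log t steps bring the bound below t⁻². Base changes
turn this into the time in the theorem.

For a half-edge h, `redThrough` records whether its far end is red when the vertex one comes from is
pessimistically counted as red. If no short cycle is seen through h (h is not `Tangled`), the
branches beyond h end in disjoint sets of vertices. For fixed polls the branches are then
independent, and the far end is red at time n with probability at most `redBound r α n`
(`measure_redThrough_le`). A union bound disposes of all untangled half-edges.

A vertex that is red at time n + 1 has polled at least r + 1 ≥ 3 red neighbours, and by the above
these sit behind tangled half-edges. Vertices outside a core of about t ^ b oldest vertices have at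
most two tangled half-edges. Core vertices have few tangled half-edges compared with their degree,
at least t ^ (3b), so at time n they are unlikely to poll any of them (`protocolLaw_red_le`). Once
all vertices are blue they remain so, hence one time step suffices.

The graph estimates are first moment bounds. Rising factorial moments give D_j(i) ≤ M √(i / j) up to
shifts, with M of order log t. On this event the probability of prescribed edges is at most a
product of M-dependent constants and of 1 / √(y + 1) over all edge ends y (`avg_edges_le`). In a
small subgraph where only v may be a leaf, every other vertex occurs at least twice and so
contributes at most one harmonic sum. With degree κ at v this leaves (v + 1) ^ (-κ/2) times a
polylogarithm to the power O(log log t), which is t ^ o(1) (`avg_card_leaflessTuples_le`). Taking κ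
= 3 makes the sum over v outside the core small; κ = 1 bounds the tangled half-edges inside it. A
negative moment bounds the core degrees from below (`avg_inv_degBefore_le`). -/

namespace PrefAttach

/-! ### Tails of the binomial distribution -/

/-- The probability that a binomial variable with parameters `n` and `x` is at least `k`. -/
noncomputable def binTail : ℕ → ℕ → ℝ → ℝ
  | _, 0, _ => 1
  | 0, _ + 1, _ => 0
  | n + 1, k + 1, x => x * binTail n k x + (1 - x) * binTail n (k + 1) x

@[simp] lemma binTail_zero_right (n : ℕ) (x : ℝ) : binTail n 0 x = 1 := by
  cases n <;> rfl

@[simp] lemma binTail_zero_succ (k : ℕ) (x : ℝ) : binTail 0 (k + 1) x = 0 := rfl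

lemma binTail_succ_succ (n k : ℕ) (x : ℝ) :
    binTail (n + 1) (k + 1) x = x * binTail n k x + (1 - x) * binTail n (k + 1) x := rfl

lemma binTail_of_lt {n k : ℕ} (h : n < k) (x : ℝ) : binTail n k x = 0 := by
  induction n generalizing k with
  | zero => obtain ⟨k, rfl⟩ := Nat.exists_eq_succ_of_ne_zero h.ne'; rfl
  | succ n ih =>
    obtain ⟨k, rfl⟩ := Nat.exists_eq_succ_of_ne_zero (Nat.ne_of_gt (Nat.zero_lt_of_lt h))
    rw [Nat.succ_eq_add_one, binTail_succ_succ, ih (by omega), ih (by omega)]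
    ring

/-- Consecutive tails differ by a point mass. This identifies the recursively defined tails with
those of Mathlib's `binomial`. -/
lemma binTail_sub_succ (n k : ℕ) (x : ℝ) :
    binTail n k x - binTail n (k + 1) x = n.choose k * x ^ k * (1 - x) ^ (n - k) := by
  induction n generalizing k with
  | zero => cases k <;> simp
  | succ n ih =>
    cases k with
    | zero =>
      have := ih 0
      simp only [binTail_zero_right, Nat.choose_zero_right, pow_zero, Nat.sub_zero] at this
      rw [binTail_succ_succ]
      simp only [binTail_zero_right, Nat.choose_zero_right, pow_zero, Nat.sub_zero, pow_succ]
      linear_combination (1 - x) * this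
    | succ k =>
      have h1 := ih k
      have h2 := ih (k + 1)
      rw [binTail_succ_succ, binTail_succ_succ]
      have h3 : (n + 1) - (k + 1) = n - k := by omega
      rw [h3, Nat.choose_succ_succ]
      rcases lt_or_ge k n with hk | hk
      · have h4 : n - k = (n - (k + 1)) + 1 := by omega
        rw [h4] at h1 ⊢
        push_cast
        rw [pow_succ] at h1 ⊢
        linear_combination x * h1 + (1 - x) * h2
      · have h4 : n.choose (k + 1) = 0 := Nat.choose_eq_zero_of_lt (by omega)
        rw [h4] at h2 ⊢
        push_cast
        push_cast at h2
        rw [pow_succ]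
        linear_combination x * h1 + (1 - x) * h2

lemma binomial_real_Ici (n k : ℕ) (p : unitInterval) :
    (binomial n p).real {j : ℕ | k ≤ j} = binTail n k p := by
  induction k with
  | zero => simp
  | succ k ih =>
    have h : {j : ℕ | k ≤ j} = {k} ∪ {j : ℕ | k + 1 ≤ j} := by
      ext j
      simp only [Set.mem_ofPred_eq, Set.singleton_union, Set.mem_insert_iff]
      omega
    rw [h, measureReal_union (by simp) (by measurability), binomial_real_singleton] at ih
    have := binTail_sub_succ n k p
    linarith

lemma binTail_antitone_succ {x : ℝ} (h0 : 0 ≤ x) (h1 : x ≤ 1) (n k : ℕ) :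
    binTail n (k + 1) x ≤ binTail n k x := by
  have := binTail_sub_succ n k x
  have h2 : 0 ≤ (n.choose k : ℝ) * x ^ k * (1 - x) ^ (n - k) := by
    have : 0 ≤ 1 - x := by linarith
    positivity
  linarith

lemma binTail_nonneg {x : ℝ} (h0 : 0 ≤ x) (h1 : x ≤ 1) (n k : ℕ) : 0 ≤ binTail n k x := by
  induction n generalizing k with
  | zero => cases k <;> simp
  | succ n ih =>
    cases k with
    | zero => simp
    | succ k =>
      rw [binTail_succ_succ]
      have := ih k
      have := ih (k + 1)
      have : 0 ≤ 1 - x := by linarith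
      positivity

lemma binTail_le_two_pow_mul_pow {x : ℝ} (h0 : 0 ≤ x) (h1 : x ≤ 1) (n k : ℕ) :
    binTail n k x ≤ 2 ^ n * x ^ k := by
  induction n generalizing k with
  | zero => cases k <;> simp; positivity
  | succ n ih =>
    cases k with
    | zero => simpa using one_le_pow₀ (M₀ := ℝ) (n := n + 1) (by norm_num : (1 : ℝ) ≤ 2)
    | succ k =>
      rw [binTail_succ_succ]
      have a := mul_le_mul_of_nonneg_left (ih k) h0
      have b := ih (k + 1)
      have c := mul_nonneg h0 (binTail_nonneg h0 h1 n (k + 1))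
      rw [pow_succ] at b
      rw [pow_succ, pow_succ]
      linarith

lemma continuous_binTail (n k : ℕ) : Continuous (binTail n k) := by
  induction n generalizing k with
  | zero => cases k <;> exact continuous_const
  | succ n ih =>
    cases k with
    | zero => exact continuous_const
    | succ k =>
      have h1 := ih k
      have h2 := ih (k + 1)
      change Continuous fun x => x * binTail n k x + (1 - x) * binTail n (k + 1) x
      fun_prop

/-- Among n trials there are either k successes or n + 1 - k failures, never both; failures are
binomial with parameter 1 - x. -/
lemma binTail_add_reflect (n k : ℕ) (hk : k ≤ n + 1) (x : ℝ) :
    binTail n k x + binTail n (n + 1 - k) (1 - x) = 1 := by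
  induction n generalizing k with
  | zero => interval_cases k <;> simp
  | succ n ih =>
    cases k with
    | zero => simp [binTail_of_lt]
    | succ k =>
      rcases Nat.lt_or_ge k (n + 1) with h | h
      · have e : n + 1 + 1 - (k + 1) = (n - k) + 1 := by omega
        have i1 := ih k (by omega)
        have i2 := ih (k + 1) (by omega)
        rw [show n + 1 - k = n - k + 1 by omega] at i1
        rw [show n + 1 - (k + 1) = n - k by omega] at i2
        rw [e, binTail_succ_succ, binTail_succ_succ]
        linear_combination x * i1 + (1 - x) * i2
      · obtain rfl : k = n + 1 := by omega
        simp [binTail_of_lt]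

lemma half_le_binTail_half (r : ℕ) : 1 / 2 ≤ binTail (2 * r) r (1 / 2) := by
  have h := binTail_add_reflect (2 * r) r (by omega) (1 / 2)
  rw [show 2 * r + 1 - r = r + 1 by omega, show (1 : ℝ) - 1 / 2 = 1 / 2 by norm_num] at h
  have := binTail_antitone_succ (x := 1 / 2) (by norm_num) (by norm_num) (2 * r) r
  linarith

/-- A majority of more voters is less likely to be wrong. -/
lemma binTail_majority_succ_le {x : ℝ} (h0 : 0 ≤ x) (h1 : x ≤ 1 / 2) {s : ℕ} (hs : 1 ≤ s) :
    binTail (2 * (s + 1)) (s + 1) x ≤ binTail (2 * s) s x := by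
  obtain ⟨a, rfl⟩ := Nat.exists_eq_add_of_le' hs
  have e : 2 * (a + 1 + 1) = 2 * (a + 1) + 1 + 1 := by ring
  rw [e, binTail_succ_succ, binTail_succ_succ, binTail_succ_succ]
  have hA := binTail_sub_succ (2 * (a + 1)) (a + 1) x
  have hB := binTail_sub_succ (2 * (a + 1)) a x
  rw [show 2 * (a + 1) - (a + 1) = a + 1 by omega] at hA
  rw [show 2 * (a + 1) - a = a + 2 by omega] at hB
  have hC : (((2 * (a + 1)).choose a : ℕ) : ℝ) ≤ ((2 * (a + 1)).choose (a + 1) : ℕ) := by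
    have := Nat.choose_le_centralBinom a (a + 1)
    rw [Nat.centralBinom_eq_two_mul_choose] at this
    exact_mod_cast this
  set P := binTail (2 * (a + 1)) a x
  set Q := binTail (2 * (a + 1)) (a + 1) x
  set R := binTail (2 * (a + 1)) (a + 1 + 1) x
  set c := (((2 * (a + 1)).choose a : ℕ) : ℝ)
  set c' := (((2 * (a + 1)).choose (a + 1) : ℕ) : ℝ)
  have hx : 0 ≤ 1 - x := by linarith
  have hD : x * c ≤ (1 - x) * c' := by
    have : 0 ≤ c := by positivity
    nlinarith
  -- Two further voters make the verdict wrong only if both are wrong and exactly `a` of the others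
  -- are; they make it right only if both are right and exactly `a + 1` of the others are wrong. The
  -- first case is the less likely one.
  have hE : x ^ 2 * (P - Q) ≤ (1 - x) ^ 2 * (Q - R) := by
    rw [hA, hB]
    have := mul_le_mul_of_nonneg_left hD (show 0 ≤ x ^ (a + 1) * (1 - x) ^ (a + 2) by positivity)
    calc _ = x ^ (a + 1) * (1 - x) ^ (a + 2) * (x * c) := by ring
      _ ≤ _ := this
      _ = _ := by ring
  nlinarith

lemma binTail_majority_antitone {x : ℝ} (h0 : 0 ≤ x) (h1 : x ≤ 1 / 2) {r s : ℕ} (hr : 1 ≤ r)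
    (hs : r ≤ s) : binTail (2 * s) s x ≤ binTail (2 * r) r x := by
  induction s, hs using Nat.le_induction with
  | base => rfl
  | succ s hs ih => exact (binTail_majority_succ_le h0 h1 (hr.trans hs)).trans ih

/-! ### Iteration of the majority map below its smallest positive fixed point. -/

/-- The iterates of the map `x ↦ P(Bin(2r, x) ≥ r)`. -/
noncomputable def redBound (r : ℕ) (α : ℝ) : ℕ → ℝ
  | 0 => α
  | j + 1 => binTail (2 * r) r (redBound r α j)

section FixedPoint

variable {r : ℕ} {a α : ℝ}

/-- The tail is at most (4x) ^ r ≤ 16 x². Superlinearity needs r ≥ 2, that is, d ≥ 5. -/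
lemma binTail_lt_self_of_small (hr : 2 ≤ r) {x : ℝ} (h0 : 0 < x) (h1 : 16 * x < 1) :
    binTail (2 * r) r x < x := by
  have h2 := binTail_le_two_pow_mul_pow h0.le (by linarith) (2 * r) r
  rw [pow_mul, ← mul_pow] at h2
  norm_num at h2
  have h3 : (4 * x) ^ r ≤ (4 * x) ^ 2 := pow_le_pow_of_le_one (by linarith) (by linarith) hr
  nlinarith

/-- The graph of the map is below the diagonal at 1/32 and not below it at 1/2, so it meets it in
between. This keeps the orbit in [0, 1/2], where polling more neighbours can only help. -/
lemma fixedPoint_le_half (hr : 2 ≤ r)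
    (hmin : ∀ x, 0 < x → x ≤ 1 → binTail (2 * r) r x = x → a ≤ x) : a ≤ 1 / 2 := by
  have hs : binTail (2 * r) r (1 / 32) < 1 / 32 :=
    binTail_lt_self_of_small hr (by norm_num) (by norm_num)
  have hc : ContinuousOn (fun x => binTail (2 * r) r x - x) (Set.Icc (1 / 32) (1 / 2)) :=
    ((continuous_binTail _ _).sub continuous_id).continuousOn
  obtain ⟨x, hx, hx0⟩ := intermediate_value_Icc (by norm_num) hc
    (show (0 : ℝ) ∈ Set.Icc _ _ from ⟨by linarith, by linarith [half_le_binTail_half r]⟩)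
  exact (hmin x (by linarith [hx.1]) (by linarith [hx.2]) (by simpa [sub_eq_zero] using hx0)).trans
    hx.2

lemma binTail_lt_self (hr : 2 ≤ r) (ha : a ≤ 1)
    (hmin : ∀ x, 0 < x → x ≤ 1 → binTail (2 * r) r x = x → a ≤ x) {x : ℝ} (h0 : 0 < x)
    (h1 : x < a) : binTail (2 * r) r x < x := by
  by_contra! h
  set y := min x (1 / 32)
  have hy0 : 0 < y := lt_min h0 (by norm_num)
  have hs : binTail (2 * r) r y < y :=
    binTail_lt_self_of_small hr hy0 (by have : y ≤ 1 / 32 := min_le_right _ _; linarith)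
  have hc : ContinuousOn (fun x => binTail (2 * r) r x - x) (Set.Icc y x) :=
    ((continuous_binTail _ _).sub continuous_id).continuousOn
  obtain ⟨z, hz, hz0⟩ := intermediate_value_Icc (min_le_left _ _) hc
    (show (0 : ℝ) ∈ Set.Icc _ _ from ⟨by linarith, by linarith⟩)
  have := hmin z (hy0.trans_le hz.1) (by linarith [hz.2]) (by simpa [sub_eq_zero] using hz0)
  linarith [hz.2]

lemma binTail_zero_arg {k : ℕ} (n : ℕ) (hk : 1 ≤ k) : binTail n k 0 = 0 := by
  have h1 := binTail_le_two_pow_mul_pow (x := 0) le_rfl (by norm_num) n k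
  have h2 := binTail_nonneg (x := 0) le_rfl (by norm_num) n k
  rw [zero_pow (by omega)] at h1
  linarith

lemma binTail_le_self (hr : 2 ≤ r) (ha : a ≤ 1)
    (hmin : ∀ x, 0 < x → x ≤ 1 → binTail (2 * r) r x = x → a ≤ x) {x : ℝ} (h0 : 0 ≤ x)
    (h1 : x < a) : binTail (2 * r) r x ≤ x := by
  rcases h0.eq_or_lt with rfl | h0
  · rw [binTail_zero_arg _ (by omega)]
  · exact (binTail_lt_self hr ha hmin h0 h1).le

lemma redBound_mem (hr : 2 ≤ r) (ha : a ≤ 1)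
    (hmin : ∀ x, 0 < x → x ≤ 1 → binTail (2 * r) r x = x → a ≤ x) (h0 : 0 ≤ α) (h1 : α < a)
    (j : ℕ) : 0 ≤ redBound r α j ∧ redBound r α j < a := by
  induction j with
  | zero => exact ⟨h0, h1⟩
  | succ j ih =>
    exact ⟨binTail_nonneg ih.1 (by linarith) _ _,
      (binTail_le_self hr ha hmin ih.1 ih.2).trans_lt ih.2⟩

/-- The orbit decreases, and its limit is by continuity a fixed point below `a`, hence 0. -/
lemma tendsto_redBound (hr : 2 ≤ r) (ha : a ≤ 1)
    (hmin : ∀ x, 0 < x → x ≤ 1 → binTail (2 * r) r x = x → a ≤ x) (h0 : 0 ≤ α) (h1 : α < a) :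
    Tendsto (redBound r α) atTop (𝓝 0) := by
  have hm := redBound_mem hr ha hmin h0 h1
  have hanti : Antitone (redBound r α) :=
    antitone_nat_of_succ_le fun j => binTail_le_self hr ha hmin (hm j).1 (hm j).2
  have hl := tendsto_atTop_ciInf hanti ⟨0, by rintro _ ⟨j, rfl⟩; exact (hm j).1⟩
  set l := ⨅ j, redBound r α j
  have hl0 : 0 ≤ l := ge_of_tendsto' hl fun j => (hm j).1
  have hla : l < a := (hanti.le_of_tendsto hl 0).trans_lt h1
  have hfix : binTail (2 * r) r l = l := by
    have e1 : Tendsto (fun j => redBound r α (j + 1)) atTop (𝓝 l) :=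
      hl.comp (tendsto_add_atTop_nat 1)
    have e2 : Tendsto (fun j => redBound r α (j + 1)) atTop (𝓝 (binTail (2 * r) r l)) :=
      ((continuous_binTail _ _).tendsto l).comp hl
    exact tendsto_nhds_unique e2 e1
  rcases hl0.eq_or_lt with h | h
  · rwa [← h] at hl
  · exact absurd hfix (binTail_lt_self hr ha hmin h hla).ne

/-- The iterates decay doubly exponentially. -/
lemma exists_redBound_le_exp (hr : 2 ≤ r) (ha : a ≤ 1)
    (hmin : ∀ x, 0 < x → x ≤ 1 → binTail (2 * r) r x = x → a ≤ x) (h0 : 0 ≤ α) (h1 : α < a) :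
    ∃ h : ℕ, ∀ i : ℕ, redBound r α (h + i) ≤ Real.exp (-(r : ℝ) ^ i) := by
  have hm := redBound_mem hr ha hmin h0 h1
  obtain ⟨h, hh⟩ := ((tendsto_redBound hr ha hmin h0 h1).eventually
    (gt_mem_nhds (show (0 : ℝ) < Real.exp (-1) / 16 by positivity))).exists
  refine ⟨h, fun i => ?_⟩
  -- With y = 16x the bound 4 ^ r x ^ r for the map becomes y ↦ y ^ r, because 16 = 4² ≤ 4 ^ r.
  suffices 16 * redBound r α (h + i) ≤ Real.exp (-(r : ℝ) ^ i) by linarith [(hm (h + i)).1]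
  induction i with
  | zero => simp only [add_zero, pow_zero]; linarith
  | succ i ih =>
    have e := binTail_le_two_pow_mul_pow (hm (h + i)).1 (by linarith [(hm (h + i)).2]) (2 * r) r
    have hx := (hm (h + i)).1
    change 16 * binTail (2 * r) r (redBound r α (h + i)) ≤ _
    calc 16 * binTail (2 * r) r (redBound r α (h + i))
        ≤ 4 ^ 2 * (2 ^ (2 * r) * redBound r α (h + i) ^ r) := by linarith
      _ ≤ 4 ^ r * (2 ^ (2 * r) * redBound r α (h + i) ^ r) := by
          gcongr; norm_num
      _ = (16 * redBound r α (h + i)) ^ r := by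
          rw [pow_mul, mul_pow, ← mul_assoc, ← mul_pow]; norm_num
      _ ≤ Real.exp (-(r : ℝ) ^ i) ^ r := by gcongr
      _ = Real.exp (-(r : ℝ) ^ (i + 1)) := by
          rw [← Real.exp_nat_mul, pow_succ]; congr 1; ring

end FixedPoint

/-! ### Half-edges whose surroundings contain a cycle -/

namespace Multigraph

variable {V E : Type} [DecidableEq V] [DecidableEq E]

/-- The other half of the edge of a half-edge. -/
def rev (h : E × Bool) : E × Bool := (h.1, !h.2)

/-- The number of half-edges of the edge `e` that sit at `y`. -/
def incidence (G : Multigraph V E) (e : E) (y : V) : ℕ :=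
  (if G.ends e true = y then 1 else 0) + if G.ends e false = y then 1 else 0

/-- The degree of `y` in the subgraph that consists of the edges in `F`. -/
def degIn (G : Multigraph V E) (F : Finset E) (y : V) : ℕ := ∑ e ∈ F, G.incidence e y

variable {G : Multigraph V E} {F F' : Finset E} {h h' h'' : E × Bool} {v y z : V} {ℓ j : ℕ}

lemma degIn_eq_card (G : Multigraph V E) (F : Finset E) (y : V) :
    G.degIn F y = ((F ×ˢ Finset.univ).filter fun h => G.base h = y).card := by
  rw [Finset.card_filter, Finset.sum_product]
  exact Finset.sum_congr rfl fun e _ => by rw [Fintype.sum_bool]; rfl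

lemma card_le_degIn {S : Finset (E × Bool)} (hS : ∀ h ∈ S, h.1 ∈ F ∧ G.base h = y) :
    S.card ≤ G.degIn F y := by
  rw [degIn_eq_card]
  refine Finset.card_le_card fun h hh => ?_
  simpa using hS h hh

lemma degIn_mono (hF : F ⊆ F') (y : V) : G.degIn F y ≤ G.degIn F' y :=
  Finset.sum_le_sum_of_subset hF

lemma incidence_eq_zero (h1 : y ≠ G.base h) (h2 : y ≠ G.opposite h) : G.incidence h.1 y = 0 := by
  obtain ⟨e, b⟩ := h
  simp only [base, opposite] at h1 h2
  cases b <;> simp only [Bool.not_true, Bool.not_false] at h2 <;>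
    simp [incidence, h1.symm, h2.symm]

lemma degIn_insert_of_ne (h1 : y ≠ G.base h) (h2 : y ≠ G.opposite h) :
    G.degIn (insert h.1 F) y = G.degIn F y := by
  unfold degIn
  by_cases hF : h.1 ∈ F
  · rw [Finset.insert_eq_of_mem hF]
  · rw [Finset.sum_insert hF, incidence_eq_zero h1 h2, zero_add]

/-- If one degree is at least 2, so is that in the union; otherwise all are 0. Hence edge sets
without leaves can be glued together. -/
lemma degIn_union_ne_one (h1 : G.degIn F y ≠ 1) (h2 : G.degIn F' y ≠ 1) :
    G.degIn (F ∪ F') y ≠ 1 := by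
  have a := degIn_mono (G := G) (Finset.subset_union_left (s₁ := F) (s₂ := F')) y
  have b := degIn_mono (G := G) (Finset.subset_union_right (s₁ := F) (s₂ := F')) y
  have c : G.degIn (F ∪ F') y ≤ G.degIn F y + G.degIn F' y := by
    unfold degIn
    rw [← Finset.sum_union_inter]
    exact Nat.le_add_right _ _
  omega

lemma two_le_degIn (hF : h.1 ∈ F) (hF' : h'.1 ∈ F) (hne : h ≠ h') (hy : G.base h = y)
    (hy' : G.base h' = y) : 2 ≤ G.degIn F y := by
  rw [← Finset.card_pair hne]
  exact card_le_degIn (by simp [hF, hF', hy, hy'])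

lemma three_le_degIn (hF : h.1 ∈ F) (hF' : h'.1 ∈ F) (hF'' : h''.1 ∈ F) (h1 : h ≠ h')
    (h2 : h ≠ h'') (h3 : h' ≠ h'') (hy : G.base h = y) (hy' : G.base h' = y)
    (hy'' : G.base h'' = y) : 3 ≤ G.degIn F y := by
  rw [← Finset.card_eq_three.2 ⟨h, h', h'', h1, h2, h3, rfl⟩]
  exact card_le_degIn (by simp [hF', hF'', hy', hy'', hF, hy])

/-- The edge of `h` lies in a set of at most `ℓ` edges that has no leaf except possibly at the
vertex of `h`. If `h` is not tangled, then the part of the graph seen through `h` is a tree up to a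
distance of about `ℓ / 2`. -/
def Tangled (G : Multigraph V E) (ℓ : ℕ) (h : E × Bool) : Prop :=
  ∃ F : Finset E, F.card ≤ ℓ ∧ h.1 ∈ F ∧ ∀ y, y ≠ G.base h → G.degIn F y ≠ 1

lemma Tangled.mono {ℓ' : ℕ} (hℓ : ℓ ≤ ℓ') (ht : G.Tangled ℓ h) : G.Tangled ℓ' h := by
  obtain ⟨F, h1, h2⟩ := ht
  exact ⟨F, h1.trans hℓ, h2⟩

/-- A cycle seen from the next half-edge is also seen from `h`: the two half-edges `rev h` and `h'`
prevent a leaf at the joint. -/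
lemma Tangled.of_next (ht : G.Tangled ℓ h') (hb : G.base h' = G.opposite h) (hne : h' ≠ rev h) :
    G.Tangled (ℓ + 1) h := by
  obtain ⟨F, h1, h2, h3⟩ := ht
  refine ⟨insert h.1 F, (Finset.card_insert_le _ _).trans (by omega), by simp, fun y hy => ?_⟩
  by_cases hw : y = G.opposite h
  · have := two_le_degIn (G := G) (F := insert h.1 F) (h := rev h) (h' := h') (y := y)
      (by simp [rev]) (by simp [h2]) hne.symm (by rw [hw]; rfl) (by rw [hw, hb])
    omega
  · rw [degIn_insert_of_ne hy hw]
    exact h3 y (by rwa [hb])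

/-- Leaves can be pruned without losing the edge of `h`. -/
lemma exists_leafless_subset (hF : h.1 ∈ F) (h3 : 3 ≤ G.degIn F (G.opposite h))
    (hz : ∀ y, y ≠ G.base h → y ≠ z → G.degIn F y ≠ 1) :
    ∃ F' ⊆ F, h.1 ∈ F' ∧ ∀ y, y ≠ G.base h → G.degIn F' y ≠ 1 := by
  induction hn : F.card using Nat.strong_induction_on generalizing F z with
  | _ n ih =>
  by_cases hzv : z = G.base h
  · exact ⟨F, subset_rfl, hF, fun y hy => hz y hy (by rwa [hzv])⟩
  -- If z is a leaf, remove its edge; its other end becomes the only new candidate for a leaf. The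
  -- edge of `h` survives, since z is neither of its ends. The process stops at the latest at the
  -- far end of `h`, which has degree at least 3 and can afford the loss of one edge.
  by_cases hz1 : G.degIn F z = 1
  swap
  · refine ⟨F, subset_rfl, hF, fun y hy => ?_⟩
    by_cases hyz : y = z
    · rwa [hyz]
    · exact hz y hy hyz
  have hzw : z ≠ G.opposite h := by rintro rfl; omega
  obtain ⟨g, hg⟩ := Finset.card_eq_one.1 ((degIn_eq_card G F z).symm.trans hz1)
  have hgm : g ∈ (F ×ˢ Finset.univ).filter fun h => G.base h = z := by
    rw [hg]; exact Finset.mem_singleton_self g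
  simp only [Finset.mem_filter, Finset.mem_product, Finset.mem_univ, and_true] at hgm
  have hgh : h.1 ≠ g.1 := by
    intro e
    have := incidence_eq_zero (G := G) (h := h) hzv hzw
    have h6 : 1 ≤ G.degIn {g.1} z := by
      rw [← Finset.card_singleton g]
      exact card_le_degIn (by simp [hgm.2])
    simp only [degIn, Finset.sum_singleton] at h6
    rw [← e] at h6
    omega
  have hdeg : ∀ y, G.degIn (F.erase g.1) y + G.incidence g.1 y = G.degIn F y := fun y =>
    Finset.sum_erase_add _ _ hgm.1
  have hinc : ∀ y, y ≠ z → y ≠ G.opposite g → G.incidence g.1 y = 0 := fun y h1 h2 =>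
    incidence_eq_zero (by rwa [hgm.2]) h2
  have hincz : 1 ≤ G.incidence g.1 z := by
    have h6 : 1 ≤ G.degIn {g.1} z := by
      rw [← Finset.card_singleton g]
      exact card_le_degIn (by simp [hgm.2])
    simpa [degIn] using h6
  have hz0 : G.degIn (F.erase g.1) z = 0 := by have := hdeg z; omega
  have hmem : h.1 ∈ F.erase g.1 := by simp [hF, hgh]
  have hlt : (F.erase g.1).card < n := by rw [← hn]; exact Finset.card_erase_lt_of_mem hgm.1
  have hother : ∀ y, y ≠ G.base h → y ≠ G.opposite g → G.degIn (F.erase g.1) y ≠ 1 := by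
    intro y h1 h2
    by_cases hyz : y = z
    · rw [hyz, hz0]; norm_num
    · have := hdeg y
      rw [hinc y hyz h2, add_zero] at this
      rw [this]
      exact hz y h1 hyz
  by_cases hw : G.opposite g = G.opposite h
  · refine ⟨F.erase g.1, Finset.erase_subset _ _, hmem, fun y hy => ?_⟩
    by_cases hyw : y = G.opposite g
    · have h1 := hdeg y
      have h2 : G.incidence g.1 y ≤ 1 := by
        have hne : G.base g ≠ y := by rw [hgm.2, hyw, hw]; exact hzw
        obtain ⟨e, b⟩ := g
        simp only [base] at hne
        cases b <;> simp only [incidence, hne, if_false] <;> split_ifs <;> simp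
      rw [hyw, hw] at h1 h2 ⊢
      omega
    · exact hother y hy hyw
  · obtain ⟨F', hs, h1, h2⟩ := ih _ hlt hmem
      (by
        have := hdeg (G.opposite h)
        rw [hinc _ hzw.symm (Ne.symm hw)] at this
        omega) hother rfl
    exact ⟨F', hs.trans (Finset.erase_subset _ _), h1, h2⟩

/-- Three tangled half-edges at `v` yield a small leafless subgraph in which `v` has degree at least
three. -/
lemma exists_leafless_of_three_tangled (h1 : G.Tangled ℓ h) (h2 : G.Tangled ℓ h')
    (h3 : G.Tangled ℓ h'') (e1 : h ≠ h') (e2 : h ≠ h'') (e3 : h' ≠ h'') (b1 : G.base h = v)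
    (b2 : G.base h' = v) (b3 : G.base h'' = v) :
    ∃ F : Finset E, F.card ≤ 3 * ℓ ∧ 3 ≤ G.degIn F v ∧ ∀ y, y ≠ v → G.degIn F y ≠ 1 := by
  obtain ⟨F1, c1, m1, d1⟩ := h1
  obtain ⟨F2, c2, m2, d2⟩ := h2
  obtain ⟨F3, c3, m3, d3⟩ := h3
  refine ⟨F1 ∪ F2 ∪ F3, ?_, ?_, fun y hy => ?_⟩
  · have := Finset.card_union_le (F1 ∪ F2) F3
    have := Finset.card_union_le F1 F2
    omega
  · exact three_le_degIn (by simp [m1]) (by simp [m2]) (by simp [m3]) e1 e2 e3 b1 b2 b3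
  · exact degIn_union_ne_one (degIn_union_ne_one (d1 y (by rwa [b1])) (d2 y (by rwa [b2])))
      (d3 y (by rwa [b3]))

variable [Fintype E]

lemma mem_halfEdges : h ∈ G.halfEdges v ↔ G.base h = v := by simp [halfEdges]

/-- The half-edges at the far end of `h`, without the other half of `h`. -/
def onward (G : Multigraph V E) (h : E × Bool) : Finset (E × Bool) :=
  (G.halfEdges (G.opposite h)).erase (rev h)

lemma mem_onward : h' ∈ G.onward h ↔ h' ≠ rev h ∧ G.base h' = G.opposite h := by
  simp [onward, mem_halfEdges]

/-- The vertices at the ends of the non-backtracking walks with `j + 1` steps that start with the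
half-edge `h`. -/
def leafSet (G : Multigraph V E) : ℕ → E × Bool → Finset V
  | 0, h => {G.opposite h}
  | j + 1, h => (G.onward h).biUnion (leafSet G j)

/-- The edge set of a non-backtracking walk can have leaves only at the two ends of the walk: at an
intermediate vertex the arriving and the departing half-edge are distinct. -/
lemma exists_edgeSet_of_mem_leafSet (hz : z ∈ G.leafSet j h) :
    ∃ F : Finset E, F.card ≤ j + 1 ∧ h.1 ∈ F ∧
      ∀ y, y ≠ G.base h → y ≠ z → G.degIn F y ≠ 1 := by
  induction j generalizing h with
  | zero =>
    simp only [leafSet, Finset.mem_singleton] at hz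
    refine ⟨{h.1}, by simp, by simp, fun y h1 h2 => ?_⟩
    rw [hz] at h2
    simp [degIn, incidence_eq_zero h1 h2]
  | succ j ih =>
    simp only [leafSet, Finset.mem_biUnion] at hz
    obtain ⟨h', hh', hz⟩ := hz
    rw [mem_onward] at hh'
    obtain ⟨F, h1, h2, h3⟩ := ih hz
    refine ⟨insert h.1 F, (Finset.card_insert_le _ _).trans (by omega), by simp,
      fun y hy hyz => ?_⟩
    by_cases hw : y = G.opposite h
    · have := two_le_degIn (G := G) (F := insert h.1 F) (h := rev h) (h' := h') (y := y)
        (by simp [rev]) (by simp [h2]) hh'.1.symm (by rw [hw]; rfl) (by rw [hw, hh'.2])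
      omega
    · rw [degIn_insert_of_ne hy hw]
      exact h3 y (by rwa [hh'.2]) hyz

/-- Two walks that leave the far end of `h` by different half-edges and end in the same vertex close
up. They may share a final stretch, which makes the common end a leaf; pruning it back yields a
witness that `h` is tangled. The size is 2(j + 1) edges for the walks and one for `h`. -/
lemma disjoint_leafSet (ht : ¬ G.Tangled (2 * j + 3) h) (h1 : h' ∈ G.onward h)
    (h2 : h'' ∈ G.onward h) (hne : h' ≠ h'') : Disjoint (G.leafSet j h') (G.leafSet j h'') := by
  rw [Finset.disjoint_left]
  intro z hz1 hz2
  apply ht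
  rw [mem_onward] at h1 h2
  obtain ⟨F1, c1, m1, d1⟩ := exists_edgeSet_of_mem_leafSet hz1
  obtain ⟨F2, c2, m2, d2⟩ := exists_edgeSet_of_mem_leafSet hz2
  have hw3 : 3 ≤ G.degIn (insert h.1 (F1 ∪ F2)) (G.opposite h) :=
    three_le_degIn (h := rev h) (h' := h') (h'' := h'') (by simp [rev]) (by simp [m1])
      (by simp [m2]) h1.1.symm h2.1.symm hne rfl h1.2 h2.2
  obtain ⟨F', hs, hm, hF'⟩ := exists_leafless_subset (G := G) (h := h) (z := z)
    (Finset.mem_insert_self _ _) hw3 (fun y hy hyz => by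
      by_cases hw : y = G.opposite h
      · rw [hw]; omega
      · rw [degIn_insert_of_ne hy hw]
        exact degIn_union_ne_one (d1 y (by rwa [h1.2]) hyz) (d2 y (by rwa [h2.2]) hyz))
  refine ⟨F', (Finset.card_le_card hs).trans ?_, hm, hF'⟩
  have := Finset.card_insert_le h.1 (F1 ∪ F2)
  have := Finset.card_union_le F1 F2
  omega

end Multigraph

/-! ### The protocol seen through a half-edge -/

section RedThrough

variable {V E : Type} [Fintype V] [DecidableEq V] [Fintype E] [DecidableEq E]
variable {G : Multigraph V E} {c c' : V → Colour} {polls : ℕ × V → Finset (E × Bool)}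

open Multigraph

open Classical in
/-- The far end of `h` is red at time `j`, if every vertex regards the vertex from which it is
reached as red. -/
def redThrough (G : Multigraph V E) (polls : ℕ × V → Finset (E × Bool)) (c : V → Colour) :
    ℕ → E × Bool → Prop
  | 0, h => c (G.opposite h) = .red
  | j + 1, h => (polls (j, G.opposite h)).card <
      2 * ((polls (j, G.opposite h)).filter fun h' => h' = rev h ∨ redThrough G polls c j h').card

-- Counting the vertex one came from as red only adds red votes.
open Classical in
lemma redThrough_of_colourAt {j : ℕ} {h : E × Bool}
    (hc : colourAt G c polls j (G.opposite h) = .red) : redThrough G polls c j h := by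
  induction j generalizing h with
  | zero => exact hc
  | succ j ih =>
    simp only [colourAt] at hc
    split_ifs at hc with hlt
    simp only [redThrough]
    refine hlt.trans_le (Nat.mul_le_mul_left 2 (Finset.card_le_card ?_))
    exact Finset.monotone_filter_right _ fun h' _ hh' => Or.inr (ih hh')

-- The vote of `rev h` is counted without inspection, so the recursion only moves onward and never
-- returns through the edge by which it came.
open Classical in
lemma redThrough_congr (hp : ∀ i v, polls (i, v) ⊆ G.halfEdges v) {j : ℕ} {h : E × Bool}
    (hc : ∀ v ∈ G.leafSet j h, c v = c' v) :
    redThrough G polls c j h ↔ redThrough G polls c' j h := by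
  induction j generalizing h with
  | zero => simp [redThrough, hc (G.opposite h) (by simp [leafSet])]
  | succ j ih =>
    simp only [redThrough]
    have : ∀ h' ∈ polls (j, G.opposite h),
        (h' = rev h ∨ redThrough G polls c j h') ↔ (h' = rev h ∨ redThrough G polls c' j h') := by
      intro h' hh'
      by_cases e : h' = rev h
      · simp [e]
      · have hm : h' ∈ G.onward h := mem_onward.2 ⟨e, mem_halfEdges.1 (hp _ _ hh')⟩
        simp only [e, false_or]
        exact ih fun v hv => hc v (by simp only [leafSet, Finset.mem_biUnion]; exact ⟨h', hm, hv⟩)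
    rw [Finset.filter_congr this]

end RedThrough

/-! ### Independence of the initial colours -/

instance : Fintype Colour := ⟨{.red, .blue}, fun c => by cases c <;> decide⟩

instance : DiscreteMeasurableSpace Colour := ⟨fun _ => trivial⟩

section Independence

variable {V ι : Type} [Fintype V]

/-- Whether a colouring belongs to the event `A` depends only on the colours of the vertices
in `S`. -/
def DeterminedOn (A : Set (V → Colour)) (S : Finset V) : Prop :=
  ∀ c c' : V → Colour, (∀ v ∈ S, c v = c' v) → (c ∈ A ↔ c' ∈ A)

lemma measure_inter_of_determinedOn (ν : V → Measure Colour) [∀ v, IsProbabilityMeasure (ν v)]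
    {A B : Set (V → Colour)} {S T : Finset V} (hA : DeterminedOn A S) (hB : DeterminedOn B T)
    (hST : Disjoint S T) :
    (Measure.pi ν).real (A ∩ B) = (Measure.pi ν).real A * (Measure.pi ν).real B := by
  have hind := (iIndepFun_pi (μ := ν) (X := fun _ => id)
    (fun _ => aemeasurable_id)).indepFun_finset S T hST (fun v => measurable_pi_apply v)
  -- An event determined on S is the preimage of its own set of restrictions to S, so independence
  -- of the two coordinate families applies.
  have key : ∀ {A : Set (V → Colour)} {S : Finset V}, DeterminedOn A S →
      A = (fun (c : V → Colour) (i : S) => id (c i)) ⁻¹'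
        {x : S → Colour | ∃ c ∈ A, ∀ i : S, c i = x i} := by
    intro A S hA
    ext c
    constructor
    · exact fun hc => ⟨c, hc, fun _ => rfl⟩
    · rintro ⟨c', hc', h⟩
      exact (hA c' c fun v hv => h ⟨v, hv⟩).1 hc'
  have := hind.measure_inter_preimage_eq_mul
    {x : S → Colour | ∃ c ∈ A, ∀ i : S, c i = x i} {x : T → Colour | ∃ c ∈ B, ∀ i : T, c i = x i}
    MeasurableSet.of_discrete MeasurableSet.of_discrete
  rw [← key hA, ← key hB] at this
  simp only [measureReal_def, this, ENNReal.toReal_mul]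

open Classical in
/-- If events that depend on disjoint sets of vertices have probability at most `x`, then the number
of those that occur is stochastically dominated by a binomial variable. -/
lemma measure_card_le_binTail [DecidableEq V] (ν : V → Measure Colour)
    [∀ v, IsProbabilityMeasure (ν v)]
    {x : ℝ} (hx0 : 0 ≤ x) (hx1 : x ≤ 1) (I : Finset ι) (A : ι → Set (V → Colour))
    (S : ι → Finset V) (hS : (I : Set ι).PairwiseDisjoint S)
    (hA : ∀ i ∈ I, DeterminedOn (A i) (S i)) (hp : ∀ i ∈ I, (Measure.pi ν).real (A i) ≤ x)
    (k : ℕ) :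
    (Measure.pi ν).real {c | k ≤ (I.filter fun i => c ∈ A i).card} ≤ binTail I.card k x := by
  induction I using Finset.induction_on generalizing k with
  | empty =>
    cases k with
    | zero => simp
    | succ k => simp
  | insert a I ha ih =>
    cases k with
    | zero => simp
    | succ k =>
      have ih := ih (hS.subset (by simp)) (fun i hi => hA i (by simp [hi]))
        (fun i hi => hp i (by simp [hi]))
      set C : ℕ → Set (V → Colour) := fun k => {c | k ≤ (I.filter fun i => c ∈ A i).card}
      have hC : ∀ k, DeterminedOn (C k) (I.biUnion S) := by
        intro k c c' h
        have : I.filter (fun i => c ∈ A i) = I.filter (fun i => c' ∈ A i) :=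
          Finset.filter_congr fun i hi => hA i (by simp [hi]) c c' fun v hv =>
            h v (Finset.mem_biUnion.2 ⟨i, hi, hv⟩)
        simp only [C, Set.mem_ofPred_eq, this]
      have hdis : Disjoint (S a) (I.biUnion S) := by
        rw [Finset.disjoint_biUnion_right]
        intro i hi
        exact hS (by simp) (by simp [hi]) (by rintro rfl; exact ha hi)
      have hAa := hA a (by simp)
      have hAc : DeterminedOn (A a)ᶜ (S a) := fun c c' h => not_congr (hAa c c' h)
      have hunion : {c | k + 1 ≤ ((insert a I).filter fun i => c ∈ A i).card} =
          (A a ∩ C k) ∪ ((A a)ᶜ ∩ C (k + 1)) := by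
        ext c
        by_cases hc : c ∈ A a
        · simp [Finset.filter_insert, hc, C, ha]
        · simp [Finset.filter_insert, hc, C]
      rw [hunion, measureReal_union
        ((disjoint_compl_right).mono Set.inter_subset_left Set.inter_subset_left)
        MeasurableSet.of_discrete, measure_inter_of_determinedOn ν hAa (hC k) hdis,
        measure_inter_of_determinedOn ν hAc (hC (k + 1)) hdis,
        probReal_compl_eq_one_sub MeasurableSet.of_discrete, Finset.card_insert_of_notMem ha,
        binTail_succ_succ]
      have h1 : (Measure.pi ν).real (C k) ≤ binTail I.card k x := ih k
      have h2 : (Measure.pi ν).real (C (k + 1)) ≤ binTail I.card (k + 1) x := ih (k + 1)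
      -- The mixture p T(k) + (1 - p) T(k + 1) of tails increases with p because T(k) ≥ T(k + 1), so
      -- p may be replaced by its upper bound x.
      have h3 := binTail_antitone_succ hx0 hx1 I.card k
      have h4 := hp a (by simp)
      have h5 : 0 ≤ (Measure.pi ν).real (A a) := measureReal_nonneg
      nlinarith

end Independence

/-! ### The probability of being red through a half-edge -/

section Protocol

variable {V E : Type} [Fintype V] [DecidableEq V] [Fintype E] [DecidableEq E]
variable {G : Multigraph V E} {polls : ℕ × V → Finset (E × Bool)}

open Multigraph

open Classical in
/-- Given the polls, a vertex that is reached through a half-edge with tree-like surroundings is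
unlikely to be red. -/
lemma measure_redThrough_le {r : ℕ} (hr : 1 ≤ r) {α : unitInterval}
    (hx : ∀ j, 0 ≤ redBound r α j ∧ redBound r α j ≤ 1 / 2)
    (hp : ∀ i v, polls (i, v) ⊆ G.halfEdges v)
    (hodd : ∀ i v, ∃ s, r ≤ s ∧ (polls (i, v)).card = 2 * s + 1) (j : ℕ) (h : E × Bool)
    (ht : ¬ G.Tangled (2 * j + 1) h) :
    (Measure.pi fun _ : V => bernoulliMeasure Colour.red Colour.blue α).real
      {c | redThrough G polls c j h} ≤ redBound r α j := by
  induction j generalizing h with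
  | zero =>
    have : {c : V → Colour | redThrough G polls c 0 h} =
        Function.eval (β := fun _ : V => Colour) (G.opposite h) ⁻¹' {Colour.red} := by
      ext c; simp [redThrough]
    rw [this, measureReal_def,
      (measurePreserving_eval _ (G.opposite h)).measure_preimage
        (MeasurableSet.of_discrete.nullMeasurableSet), ← measureReal_def,
      bernoulliMeasure_real_apply _ MeasurableSet.of_discrete]
    simp [redBound]
  | succ j ih =>
    set P := polls (j, G.opposite h) with hP
    set I := P.erase (rev h)
    have hI : ∀ h' ∈ I, h' ∈ G.onward h := fun h' hh' => by
      rw [Finset.mem_erase] at hh'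
      exact mem_onward.2 ⟨hh'.1, mem_halfEdges.1 (hp _ _ hh'.2)⟩
    have hcount := measure_card_le_binTail
      (fun _ : V => bernoulliMeasure Colour.red Colour.blue α) (hx j).1
      ((hx j).2.trans (by norm_num)) I (fun h' => {c | redThrough G polls c j h'}) (G.leafSet j)
      (fun a ha b hb hab => disjoint_leafSet ht (hI a ha) (hI b hb) hab)
      (fun i _ c c' hc => redThrough_congr hp hc)
      (fun i hi => ih i fun ht' => ht <|
        (ht'.of_next (mem_onward.1 (hI i hi)).2 (mem_onward.1 (hI i hi)).1).mono (by omega))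
    obtain ⟨s, hs, hcard⟩ := hodd j (G.opposite h)
    rw [← hP] at hcard
    have hfin : binTail (2 * s) s (redBound r α j) ≤ redBound r α (j + 1) :=
      binTail_majority_antitone (hx j).1 (hx j).2 hr hs
    -- If the edge back is polled, its vote is red by convention, and s red votes among the other 2s
    -- suffice. This is the origin of the tail Bin(2r, x) ≥ r.
    by_cases hrev : rev h ∈ P
    · have hIc : I.card = 2 * s := by
        rw [Finset.card_erase_of_mem hrev, hcard]; rfl
      refine le_trans (measureReal_mono ?_) ((hcount s).trans (by rwa [hIc]))
      intro c hc
      simp only [Set.mem_ofPred_eq, redThrough] at hc ⊢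
      rw [← hP] at hc
      have hsub : (P.filter fun h' => h' = rev h ∨ redThrough G polls c j h') ⊆
          insert (rev h) (I.filter fun h' => redThrough G polls c j h') := by
        intro h' hh'
        simp only [Finset.mem_filter, Finset.mem_insert, I, Finset.mem_erase] at hh' ⊢
        tauto
      have := (Finset.card_le_card hsub).trans (Finset.card_insert_le _ _)
      omega
    -- If the edge back is not polled, s + 1 red votes among 2s + 1 are required, which is less
    -- likely still.
    · have hIc : I.card = 2 * s + 1 := by
        rw [← hcard]; exact congrArg _ (Finset.erase_eq_of_notMem hrev)
      have hle : binTail (2 * s + 1) (s + 1) (redBound r α j) ≤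
          binTail (2 * s) s (redBound r α j) := by
        rw [binTail_succ_succ]
        have := binTail_antitone_succ (hx j).1 ((hx j).2.trans (by norm_num)) (2 * s) s
        have := (hx j).2
        nlinarith
      refine le_trans (measureReal_mono ?_)
        ((hcount (s + 1)).trans (by rw [hIc]; exact hle.trans hfin))
      intro c hc
      simp only [Set.mem_ofPred_eq, redThrough] at hc ⊢
      rw [← hP] at hc
      have hsub : (P.filter fun h' => h' = rev h ∨ redThrough G polls c j h') ⊆
          (I.filter fun h' => redThrough G polls c j h') := by
        intro h' hh'
        simp only [Finset.mem_filter, I, Finset.mem_erase] at hh' ⊢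
        have : h' ≠ rev h := by rintro rfl; exact hrev hh'.1
        tauto
      have := Finset.card_le_card hsub
      omega

lemma measurable_redThrough (c : V → Colour) (j : ℕ) (h : E × Bool) :
    Measurable fun polls : ℕ × V → Finset (E × Bool) => redThrough G polls c j h := by
  classical
  induction j generalizing h with
  | zero => exact measurable_const
  | succ j ih =>
    have hm : Measurable fun polls : ℕ × V → Finset (E × Bool) =>
        (polls (j, G.opposite h), fun h' => redThrough G polls c j h') :=
      (measurable_pi_apply _).prodMk (measurable_pi_iff.2 ih)
    exact (Measurable.of_discrete (f := fun q : Finset (E × Bool) × (E × Bool → Prop) =>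
      q.1.card < 2 * (q.1.filter fun h' => h' = rev h ∨ q.2 h').card)).comp hm

lemma measurable_colourAt (c : V → Colour) (j : ℕ) :
    Measurable fun polls : ℕ × V → Finset (E × Bool) => colourAt G c polls j := by
  induction j with
  | zero => exact measurable_const
  | succ j ih =>
    refine measurable_pi_iff.2 fun v => ?_
    have hm : Measurable fun polls : ℕ × V → Finset (E × Bool) =>
        (polls (j, v), colourAt G c polls j) := (measurable_pi_apply _).prodMk ih
    exact (Measurable.of_discrete (f := fun q : Finset (E × Bool) × (V → Colour) =>
      if q.1.card < 2 * (q.1.filter fun h => q.2 (G.opposite h) = .red).card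
      then Colour.red else Colour.blue)).comp hm

/-! ### Polls -/

/-- A uniformly random s-subset of A contains a given element with probability s / |A|: removing
that element leaves an (s - 1)-subset of the rest. -/
lemma card_filter_mem_powersetCard_mul {ι : Type} [DecidableEq ι] (A : Finset ι) {a : ι}
    (ha : a ∈ A) (s : ℕ) :
    ((A.powersetCard s).filter fun S => a ∈ S).card * A.card ≤ s * (A.powersetCard s).card := by
  cases s with
  | zero => simp
  | succ s =>
    have hsub : ((A.powersetCard (s + 1)).filter fun S => a ∈ S) ⊆
        ((A.erase a).powersetCard s).image (insert a) := by
      intro S hS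
      rw [Finset.mem_filter, Finset.mem_powersetCard] at hS
      refine Finset.mem_image.2 ⟨S.erase a, Finset.mem_powersetCard.2
        ⟨Finset.erase_subset_erase _ hS.1.1, ?_⟩, Finset.insert_erase hS.2⟩
      rw [Finset.card_erase_of_mem hS.2, hS.1.2]; rfl
    have h1 := (Finset.card_le_card hsub).trans Finset.card_image_le
    rw [Finset.card_powersetCard, Finset.card_erase_of_mem ha] at h1
    obtain ⟨n, hn⟩ := Nat.exists_eq_succ_of_ne_zero (Finset.card_ne_zero_of_mem ha)
    rw [Finset.card_powersetCard, hn]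
    rw [hn] at h1
    have h2 := Nat.add_one_mul_choose_eq n s
    simp only [Nat.succ_eq_add_one, Nat.add_sub_cancel] at h1 ⊢
    calc _ ≤ n.choose s * (n + 1) := Nat.mul_le_mul_right _ h1
      _ = (s + 1) * (n + 1).choose (s + 1) := by rw [mul_comm, h2, mul_comm]

lemma pollSize_le_left (k D : ℕ) : pollSize k D ≤ k := by
  unfold pollSize
  split_ifs <;> omega

lemma pollLaw_mem_le (G : Multigraph V E) (k : ℕ) {v : V} {h : E × Bool} (hh : h ∈ G.halfEdges v) :
    (pollLaw G k v).toMeasure {S | h ∈ S} ≤ ENNReal.ofReal (k / G.degree v) := by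
  unfold pollLaw
  rw [PMF.toMeasure_uniformOfFinset_apply _ _ (measurableSet_mem_finset h)]
  have hD : (0 : ℝ) < G.degree v := by
    have : 0 < (G.halfEdges v).card := Finset.card_pos.2 ⟨h, hh⟩
    exact_mod_cast this
  have hC : 0 < ((G.halfEdges v).powersetCard (pollSize k (G.degree v))).card :=
    Finset.card_pos.2 (Finset.powersetCard_nonempty.2 (pollSize_le k (G.degree v)))
  have hC' : (0 : ℝ) < ((G.halfEdges v).powersetCard (pollSize k (G.degree v))).card := by
    exact_mod_cast hC
  have hmul := card_filter_mem_powersetCard_mul (G.halfEdges v) hh (pollSize k (G.degree v))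
  have hmul' := hmul.trans (Nat.mul_le_mul_right _ (pollSize_le_left k (G.degree v)))
  rw [← ENNReal.ofReal_natCast, ← ENNReal.ofReal_natCast, ← ENNReal.ofReal_div_of_pos hC']
  apply ENNReal.ofReal_le_ofReal
  rw [div_le_div_iff₀ hC' hD]
  convert (Nat.cast_le (α := ℝ)).2 hmul' using 1
  · push_cast
    congr
  · push_cast; rfl

/-- Every poll is a set of the prescribed size of half-edges at its vertex. -/
def ValidPolls (G : Multigraph V E) (k : ℕ) (polls : ℕ × V → Finset (E × Bool)) : Prop :=
  ∀ i, polls i ∈ (G.halfEdges i.2).powersetCard (pollSize k (G.degree i.2))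

lemma ae_validPolls (G : Multigraph V E) (k : ℕ) :
    ∀ᵐ polls ∂(Measure.infinitePi fun i : ℕ × V => (pollLaw G k i.2).toMeasure),
      ValidPolls G k polls := by
  unfold ValidPolls
  rw [ae_all_iff]
  intro i
  have h1 : ∀ᵐ S ∂(pollLaw G k i.2).toMeasure,
      S ∈ (G.halfEdges i.2).powersetCard (pollSize k (G.degree i.2)) := by
    rw [ae_iff, PMF.toMeasure_apply_eq_zero_iff _ MeasurableSet.of_discrete, Set.disjoint_left]
    intro S hS
    rw [pollLaw, PMF.support_uniformOfFinset] at hS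
    simpa using hS
  exact (measurePreserving_eval_infinitePi
    (fun i : ℕ × V => (pollLaw G k i.2).toMeasure) i).quasiMeasurePreserving.ae h1

/-! ### The probability that some vertex is red -/

lemma sum_ofReal_add_sum_ofReal {x : ℝ} (hx : 0 ≤ x) (core : Finset V)
    (S : V → Finset (E × Bool)) (w : V → ℝ) (hw : ∀ u, 0 ≤ w u) :
    ∑ _h : E × Bool, ENNReal.ofReal x + ∑ u ∈ core, ∑ _h ∈ S u, ENNReal.ofReal (w u) =
      ENNReal.ofReal (2 * Fintype.card E * x + ∑ u ∈ core, (S u).card * w u) := by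
  have e1 : ∑ _h : E × Bool, ENNReal.ofReal x = ENNReal.ofReal (2 * Fintype.card E * x) := by
    rw [← ENNReal.ofReal_sum_of_nonneg fun _ _ => hx, Finset.sum_const, Finset.card_univ,
      Fintype.card_prod, Fintype.card_bool, nsmul_eq_mul]
    push_cast
    rw [mul_comm (Fintype.card E : ℝ) 2]
  have e2 : ∀ u, ∑ _h ∈ S u, ENNReal.ofReal (w u) = ENNReal.ofReal ((S u).card * w u) := by
    intro u
    rw [← ENNReal.ofReal_sum_of_nonneg fun _ _ => hw u, Finset.sum_const, nsmul_eq_mul]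
  have e3 : ∀ u, 0 ≤ (S u).card * w u := fun u => mul_nonneg (Nat.cast_nonneg _) (hw u)
  rw [e1, Finset.sum_congr rfl fun u _ => e2 u, ← ENNReal.ofReal_sum_of_nonneg fun u _ => e3 u,
    ENNReal.ofReal_add (by positivity) (Finset.sum_nonneg fun u _ => e3 u)]

open Classical in
/-- The half-edges at `v` whose surroundings are not tree-like. -/
noncomputable def tangledAt (G : Multigraph V E) (ℓ : ℕ) (v : V) : Finset (E × Bool) :=
  (G.halfEdges v).filter fun h => G.Tangled ℓ h

-- A red vertex has polled at least r + 1 ≥ 3 red neighbours. If no untangled half-edge leads to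
-- red, all of them are reached through tangled half-edges, of which only core vertices have enough.
open Classical in
lemma exists_of_colourAt_succ_red {r : ℕ} (hr : 2 ≤ r) {k n : ℕ} {c : V → Colour}
    (hv : ValidPolls G k polls) (hodd : ∀ i v, ∃ s, r ≤ s ∧ (polls (i, v)).card = 2 * s + 1)
    {core : Finset V} (hcore : ∀ v ∉ core, (tangledAt G (2 * n + 1) v).card ≤ 2) {v : V}
    (hred : colourAt G c polls (n + 1) v = .red) :
    (∃ h, ¬ G.Tangled (2 * n + 1) h ∧ redThrough G polls c n h) ∨
      ∃ u ∈ core, ∃ h ∈ tangledAt G (2 * n + 1) u, h ∈ polls (n, u) := by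
  by_contra! hcon
  obtain ⟨h1, h2⟩ := hcon
  simp only [colourAt] at hred
  split_ifs at hred with hlt
  obtain ⟨s, hs, hcard⟩ := hodd n v
  set R := (polls (n, v)).filter fun h => colourAt G c polls n (G.opposite h) = .red
  have hR : R ⊆ tangledAt G (2 * n + 1) v := by
    intro h hh
    rw [Finset.mem_filter] at hh
    refine Finset.mem_filter.2 ⟨(Finset.mem_powersetCard.1 (hv (n, v))).1 hh.1, ?_⟩
    by_contra ht
    exact h1 h ht (redThrough_of_colourAt hh.2)
  by_cases hvc : v ∈ core
  · obtain ⟨h, hh⟩ : R.Nonempty := Finset.card_pos.1 (by omega)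
    exact h2 v hvc h (hR hh) (Finset.mem_filter.1 hh).1
  · have := (Finset.card_le_card hR).trans (hcore v hvc)
    omega

open Classical in
/-- The probability that some vertex is red at time `n + 1`, on a graph in which only the
vertices of `core` may have more than two half-edges with cycles nearby. -/
theorem protocolLaw_red_le {r : ℕ} (hr : 2 ≤ r) {α : unitInterval} {k n : ℕ}
    (hx : ∀ j, 0 ≤ redBound r α j ∧ redBound r α j ≤ 1 / 2)
    (hodd : ∀ v, ∃ s, r ≤ s ∧ pollSize k (G.degree v) = 2 * s + 1)
    {core : Finset V} (hcore : ∀ v ∉ core, (tangledAt G (2 * n + 1) v).card ≤ 2) :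
    protocolLaw G k α {ω | ∃ v, colourAt G ω.1 ω.2 (n + 1) v = .red} ≤
      ENNReal.ofReal (2 * Fintype.card E * redBound r α n +
        ∑ u ∈ core, ((tangledAt G (2 * n + 1) u).card : ℝ) * ((k : ℝ) / (G.degree u : ℝ))) := by
  set μ := Measure.pi fun _ : V => bernoulliMeasure Colour.red Colour.blue α with hμ
  set ν := Measure.infinitePi fun i : ℕ × V => (pollLaw G k i.2).toMeasure with hν
  have hlaw : protocolLaw G k α = μ.prod ν := rfl
  have hvalid : ∀ p, ValidPolls G k p → ∀ i v, ∃ s, r ≤ s ∧ (p (i, v)).card = 2 * s + 1 := by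
    intro p hp i v
    obtain ⟨s, hs, he⟩ := hodd v
    exact ⟨s, hs, by rw [(Finset.mem_powersetCard.1 (hp (i, v))).2, he]⟩
  set B₀ : Set ((V → Colour) × (ℕ × V → Finset (E × Bool))) := {ω | ¬ ValidPolls G k ω.2}
  set B₁ : E × Bool → Set ((V → Colour) × (ℕ × V → Finset (E × Bool))) :=
    fun h => {ω | ¬ G.Tangled (2 * n + 1) h ∧ redThrough G ω.2 ω.1 n h}
  set B₂ : V → E × Bool → Set ((V → Colour) × (ℕ × V → Finset (E × Bool))) :=
    fun u h => {ω | h ∈ ω.2 (n, u)}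
  have hsub : {ω | ∃ v, colourAt G ω.1 ω.2 (n + 1) v = .red} ⊆
      (B₀ ∪ ⋃ h ∈ (Finset.univ : Finset (E × Bool)), B₁ h) ∪
        ⋃ u ∈ core, ⋃ h ∈ tangledAt G (2 * n + 1) u, B₂ u h := by
    rintro ω ⟨v, hv⟩
    by_cases hval : ValidPolls G k ω.2
    · rcases exists_of_colourAt_succ_red hr hval (hvalid _ hval) hcore hv with ⟨h, h1, h2⟩ | h
      · exact Or.inl (Or.inr (Set.mem_biUnion (Finset.mem_univ h) ⟨h1, h2⟩))
      · obtain ⟨u, hu, h, hh, hm⟩ := h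
        exact Or.inr (Set.mem_biUnion hu (Set.mem_biUnion hh hm))
    · exact Or.inl (Or.inl hval)
  have h0 : (μ.prod ν) B₀ = 0 := by
    have : B₀ = Prod.snd ⁻¹' {p | ¬ ValidPolls G k p} := rfl
    rw [this]
    exact Measure.quasiMeasurePreserving_snd.preimage_null (ae_iff.1 (ae_validPolls G k))
  have h1 : ∀ h, (μ.prod ν) (B₁ h) ≤ ENNReal.ofReal (redBound r α n) := by
    intro h
    by_cases ht : G.Tangled (2 * n + 1) h
    · simp [B₁, ht]
    have hB : B₁ h = {ω | redThrough G ω.2 ω.1 n h} := by simp [B₁, ht]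
    have hmeas : MeasurableSet {ω : (V → Colour) × (ℕ × V → Finset (E × Bool)) |
        redThrough G ω.2 ω.1 n h} :=
      measurableSet_setOfPred.2
        (measurable_from_prod_countable_right fun c => measurable_redThrough c n h)
    -- The colours are integrated first with the polls fixed; the resulting bound is the same for
    -- all valid polls.
    rw [hB, Measure.prod_apply_symm hmeas]
    calc _ ≤ ∫⁻ _, ENNReal.ofReal (redBound r α n) ∂ν := by
          refine lintegral_mono_ae ?_
          filter_upwards [ae_validPolls G k] with p hp
          have := measure_redThrough_le (G := G) (polls := p) (by omega : 1 ≤ r) hx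
            (fun i v => (Finset.mem_powersetCard.1 (hp (i, v))).1) (hvalid p hp) n h ht
          rw [measureReal_def] at this
          exact (ENNReal.le_ofReal_iff_toReal_le (measure_ne_top _ _) (hx n).1).2 this
      _ = _ := by simp
  have h2 : ∀ u, ∀ h ∈ tangledAt G (2 * n + 1) u,
      (μ.prod ν) (B₂ u h) ≤ ENNReal.ofReal (k / G.degree u) := by
    intro u h hh
    refine le_trans (le_of_eq ?_) (pollLaw_mem_le G k (Finset.mem_filter.1 hh).1)
    have e1 := (measurePreserving_eval_infinitePi
      (fun i : ℕ × V => (pollLaw G k i.2).toMeasure) (n, u)).measure_preimage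
        (measurableSet_mem_finset h).nullMeasurableSet
    rw [← e1]
    exact (measurePreserving_snd (μ := μ) (ν := ν)).measure_preimage
      (measurable_pi_apply (n, u) (measurableSet_mem_finset h)).nullMeasurableSet
  rw [hlaw]
  calc (μ.prod ν) _ ≤ _ := measure_mono hsub
    _ ≤ ((μ.prod ν) B₀ + ∑ h : E × Bool, (μ.prod ν) (B₁ h)) +
        ∑ u ∈ core, ∑ h ∈ tangledAt G (2 * n + 1) u, (μ.prod ν) (B₂ u h) := by
      refine (measure_union_le _ _).trans (add_le_add ?_ ?_)
      · exact (measure_union_le _ _).trans (add_le_add le_rfl (measure_biUnion_finset_le _ _))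
      · exact (measure_biUnion_finset_le _ _).trans
          (Finset.sum_le_sum fun u _ => measure_biUnion_finset_le _ _)
    _ ≤ (0 + ∑ _h : E × Bool, ENNReal.ofReal (redBound r α n)) +
        ∑ u ∈ core, ∑ _h ∈ tangledAt G (2 * n + 1) u, ENNReal.ofReal (k / G.degree u) := by
      gcongr with h _ u _ h hh
      · exact h0.le
      · exact h1 h
      · exact h2 u h hh
    _ = _ := by
      rw [zero_add]
      exact sum_ofReal_add_sum_ofReal (hx n).1 core (tangledAt G (2 * n + 1))
        (fun u => (k : ℝ) / (G.degree u : ℝ)) fun u => by positivity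

end Protocol

/-! ### Expectations under the law of the attachments -/

/-- The expectation of `f` under the law of `PA_n(1, δ)`. -/
noncomputable def avg (δ : ℝ≥0) (n : ℕ) (f : Attachments n → ℝ) : ℝ :=
  ∑ g, (attachmentLaw δ n g).toReal * f g

section Avg

variable {δ : ℝ≥0} {n : ℕ}

lemma avg_mono {f f' : Attachments n → ℝ} (h : ∀ g, f g ≤ f' g) : avg δ n f ≤ avg δ n f' :=
  Finset.sum_le_sum fun g _ => mul_le_mul_of_nonneg_left (h g) ENNReal.toReal_nonneg

lemma avg_nonneg {f : Attachments n → ℝ} (h : ∀ g, 0 ≤ f g) : 0 ≤ avg δ n f :=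
  Finset.sum_nonneg fun g _ => mul_nonneg ENNReal.toReal_nonneg (h g)

lemma avg_add (f f' : Attachments n → ℝ) :
    avg δ n (fun g => f g + f' g) = avg δ n f + avg δ n f' := by
  simp only [avg, mul_add, Finset.sum_add_distrib]

lemma avg_const_mul (c : ℝ) (f : Attachments n → ℝ) :
    avg δ n (fun g => c * f g) = c * avg δ n f := by
  simp only [avg, Finset.mul_sum]
  exact Finset.sum_congr rfl fun g _ => by ring

lemma avg_sum {ι : Type*} (s : Finset ι) (f : ι → Attachments n → ℝ) :
    avg δ n (fun g => ∑ i ∈ s, f i g) = ∑ i ∈ s, avg δ n (f i) := by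
  simp only [avg, Finset.mul_sum]
  exact Finset.sum_comm

lemma avg_const (c : ℝ) : avg δ n (fun _ => c) = c := by
  unfold avg
  rw [← Finset.sum_mul, ← ENNReal.toReal_sum fun g _ => PMF.apply_ne_top _ _]
  have := (attachmentLaw δ n).tsum_coe
  rw [tsum_fintype] at this
  rw [this, ENNReal.toReal_one, one_mul]

/-- Conditioning on the graph before the last step. The moment bounds below are inductions on the
number of vertices through this identity. -/
lemma avg_succ (f : Attachments (n + 1) → ℝ) :
    avg δ (n + 1) f = avg δ n fun g => ∑ x, (stepProb δ g x : ℝ) * f (g.extend x) := by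
  classical
  have hstep : ∀ (g : Attachments n) (h : Attachments (n + 1)),
      ((stepLaw δ g).map g.extend h).toReal =
        ∑ x, if h = g.extend x then (stepProb δ g x : ℝ) else 0 := by
    intro g h
    rw [PMF.map_apply, tsum_fintype, ENNReal.toReal_sum]
    · refine Finset.sum_congr rfl fun x _ => ?_
      split_ifs <;> simp [stepLaw]
    · intro x _
      split_ifs
      · exact PMF.apply_ne_top _ _
      · simp
  have hlaw : ∀ h : Attachments (n + 1), (attachmentLaw δ (n + 1) h).toReal =
      ∑ g, (attachmentLaw δ n g).toReal * ((stepLaw δ g).map g.extend h).toReal := by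
    intro h
    rw [attachmentLaw, PMF.bind_apply, tsum_fintype, ENNReal.toReal_sum]
    · simp only [ENNReal.toReal_mul]
    · exact fun g _ => ENNReal.mul_ne_top (PMF.apply_ne_top _ _) (PMF.apply_ne_top _ _)
  unfold avg
  simp only [hlaw, hstep, Finset.sum_mul, Finset.mul_sum]
  rw [Finset.sum_comm]
  refine Finset.sum_congr rfl fun g _ => ?_
  rw [Finset.sum_comm]
  refine Finset.sum_congr rfl fun x _ => ?_
  rw [Finset.sum_eq_single (g.extend x)]
  · simp; ring
  · intro h _ hne; simp [hne]
  · simp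

end Avg

/-! ### Degrees during the growth of the graph -/

/-- The degree of the vertex `j` just before the vertex `i` is added (and `1` if `i ≤ j`). -/
def degBefore {n : ℕ} (g : Attachments n) (i j : ℕ) : ℕ :=
  1 + ∑ a : Fin n, if (a : ℕ) < i ∧ ((g a : ℕ)) = j then 1 else 0

section Degrees

variable {δ : ℝ≥0} {n : ℕ}

lemma one_le_degBefore (g : Attachments n) (i j : ℕ) : 1 ≤ degBefore g i j := Nat.le_add_right _ _

lemma extend_castSucc (g : Attachments n) (x : Fin (n + 1)) (a : Fin n) :
    ((g.extend x a.castSucc : Fin _) : ℕ) = g a := by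
  unfold Attachments.extend
  rw [Fin.snoc_castSucc]

lemma extend_last (g : Attachments n) (x : Fin (n + 1)) :
    ((g.extend x (Fin.last n) : Fin _) : ℕ) = x := by
  unfold Attachments.extend
  rw [Fin.snoc_last]

lemma degBefore_extend (g : Attachments n) (x : Fin (n + 1)) {i : ℕ} (hi : i ≤ n) (j : ℕ) :
    degBefore (g.extend x) i j = degBefore g i j := by
  unfold degBefore
  rw [Fin.sum_univ_castSucc]
  simp only [extend_castSucc, Fin.val_castSucc, Fin.val_last]
  simp [Nat.not_lt.2 hi]

lemma degBefore_extend_last (g : Attachments n) (x : Fin (n + 1)) (j : ℕ) :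
    degBefore (g.extend x) (n + 1) j = degBefore g n j + if (x : ℕ) = j then 1 else 0 := by
  unfold degBefore
  rw [Fin.sum_univ_castSucc, extend_last]
  simp only [extend_castSucc, Fin.val_castSucc, Fin.val_last, Nat.lt_succ_self, true_and, add_assoc]
  congr 2
  refine Finset.sum_congr rfl fun a _ => ?_
  have := a.isLt
  simp [this, Nat.lt_succ_of_lt this]

lemma degBefore_of_le (g : Attachments n) {i j : ℕ} (h : i ≤ j) : degBefore g i j = 1 := by
  refine Nat.add_eq_left.2 (Finset.sum_eq_zero fun a _ => if_neg ?_)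
  rintro ⟨h1, h2⟩
  have := (g a).isLt
  omega

lemma degree_attachmentGraph (g : Attachments n) (j : Fin n) :
    (attachmentGraph g).degree j = degBefore g n j := by
  unfold Multigraph.degree Multigraph.halfEdges degBefore
  rw [Finset.card_filter, ← Finset.univ_product_univ, Finset.sum_product]
  simp only [Fintype.sum_bool, Finset.sum_add_distrib]
  rw [add_comm]
  congr 1
  · simp [Multigraph.base, attachmentGraph]
  · refine Finset.sum_congr rfl fun a _ => ?_
    simp [Multigraph.base, attachmentGraph, Fin.ext_iff]

/-- The normalising constant of the law of the edge of vertex `n`. -/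
noncomputable def stepNorm (δ : ℝ≥0) (n : ℕ) : ℝ := n * (2 + δ) + (1 + δ)

lemma stepNorm_ge (δ : ℝ≥0) (n : ℕ) : 2 * (n : ℝ) + 1 ≤ stepNorm δ n := by
  have h1 : 0 ≤ (δ : ℝ) := δ.2
  have h2 : 0 ≤ (n : ℝ) * δ := by positivity
  unfold stepNorm
  linarith

lemma stepNorm_pos (δ : ℝ≥0) (n : ℕ) : 0 < stepNorm δ n :=
  lt_of_lt_of_le (by positivity) (stepNorm_ge δ n)

/-- The convention that a vertex not yet present has degree 1 brings the loop at the new vertex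
under the same formula as the old vertices. -/
lemma stepProb_eq (g : Attachments n) (x : Fin (n + 1)) :
    (stepProb δ g x : ℝ) = (degBefore g n x + δ) / stepNorm δ n := by
  unfold stepProb stepNorm
  cases x using Fin.lastCases with
  | last =>
    rw [Fin.lastCases_last]
    simp [degBefore_of_le g (le_refl n)]
  | cast j =>
    rw [Fin.lastCases_castSucc, degree_attachmentGraph]
    simp

lemma sum_stepProb_real (g : Attachments n) : ∑ x, (stepProb δ g x : ℝ) = 1 := by
  have := sum_stepProb δ g
  exact_mod_cast congrArg NNReal.toReal this

lemma sum_step_degBefore (g : Attachments n) {j : ℕ} (hj : j ≤ n) (F : ℕ → ℝ) :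
    ∑ x, (stepProb δ g x : ℝ) * F (degBefore (g.extend x) (n + 1) j) =
      F (degBefore g n j) + (degBefore g n j + δ) / stepNorm δ n *
        (F (degBefore g n j + 1) - F (degBefore g n j)) := by
  have h : ∀ x : Fin (n + 1), (stepProb δ g x : ℝ) * F (degBefore (g.extend x) (n + 1) j) =
      (stepProb δ g x : ℝ) * F (degBefore g n j) +
        if x = ⟨j, Nat.lt_succ_of_le hj⟩ then (stepProb δ g x : ℝ) *
          (F (degBefore g n j + 1) - F (degBefore g n j)) else 0 := by
    intro x
    rw [degBefore_extend_last]
    by_cases hx : (x : ℕ) = j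
    · simp [hx, Fin.ext_iff]; ring
    · simp [hx, Fin.ext_iff]
  rw [Finset.sum_congr rfl fun x _ => h x, Finset.sum_add_distrib, ← Finset.sum_mul,
    sum_stepProb_real, one_mul, Finset.sum_ite_eq' Finset.univ]
  simp [stepProb_eq]

/-! ### Upper bounds for degrees -/

/-- The rising factorial. -/
noncomputable def rising (x : ℝ) (p : ℕ) : ℝ := ∏ a ∈ Finset.range p, (x + a)

/-- With this identity a growth step multiplies the conditional expectation of the p-th rising
factorial of D + δ by exactly 1 + p / N, where N is the normalising constant. Ordinary powers have
no such closed recursion. -/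
lemma rising_add_one (x : ℝ) (p : ℕ) : rising (x + 1) p * x = rising x p * (x + p) := by
  unfold rising
  rw [← Finset.prod_range_succ, Finset.prod_range_succ', Nat.cast_zero, add_zero]
  congr 1
  exact Finset.prod_congr rfl fun a _ => by push_cast; ring

lemma rising_nonneg {x : ℝ} (hx : 0 ≤ x) (p : ℕ) : 0 ≤ rising x p :=
  Finset.prod_nonneg fun _ _ => by positivity

lemma pow_le_rising {x : ℝ} (hx : 0 ≤ x) (p : ℕ) : x ^ p ≤ rising x p := by
  unfold rising
  rw [← Finset.card_range p, ← Finset.prod_const, Finset.card_range]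
  exact Finset.prod_le_prod (fun _ _ => hx) fun a _ => by simp

lemma rising_le_pow {x : ℝ} (hx : 0 ≤ x) (p : ℕ) : rising x p ≤ (x + p) ^ p := by
  unfold rising
  conv_rhs => rw [← Finset.card_range p, ← Finset.prod_const, Finset.card_range]
  refine Finset.prod_le_prod (fun _ _ => by positivity) fun a ha => ?_
  have : (a : ℝ) ≤ p := by exact_mod_cast (Finset.mem_range.1 ha).le
  linarith

lemma avg_rising_le {j : ℕ} (hj : j ≤ n) (p : ℕ) :
    avg δ n (fun g => rising (degBefore g n j + δ) p) ≤
      rising (1 + δ) p * (√(max (n : ℝ) (1 / 4) / max (j : ℝ) (1 / 4))) ^ p := by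
  have hd : 0 ≤ (δ : ℝ) := δ.2
  induction n, hj using Nat.le_induction with
  | base =>
    have hne : max (j : ℝ) (1 / 4) ≠ 0 := (lt_of_lt_of_le (by norm_num) (le_max_right _ _)).ne'
    simp only [degBefore_of_le _ (le_refl j), div_self hne, Real.sqrt_one, one_pow, mul_one,
      Nat.cast_one, avg_const, le_refl]
  | succ n hj ih =>
    have hN := stepNorm_pos δ n
    have hN' := stepNorm_ge δ n
    rw [avg_succ]
    have e : ∀ g : Attachments n, (∑ x, (stepProb δ g x : ℝ) *
        rising (degBefore (g.extend x) (n + 1) j + δ) p) =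
        (1 + p / stepNorm δ n) * rising (degBefore g n j + δ) p := by
      intro g
      rw [sum_step_degBefore g hj fun D => rising (D + δ) p]
      have h1 := rising_add_one (degBefore g n j + δ) p
      push_cast
      rw [show (degBefore g n j : ℝ) + 1 + δ = degBefore g n j + δ + 1 by ring]
      field_simp
      linear_combination h1
    rw [funext e, avg_const_mul]
    -- The factor 1 + p / N is at most (1 + 1 / (2n + 1)) ^ p, and the base is at most √((n + 1) /
    -- n) for n ≥ 1. At n = 0 the base is 2, and replacing 0 by 1/4 makes the square root equal to 2
    -- as well.
    set s : ℕ → ℝ := fun n => max (n : ℝ) (1 / 4)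
    have hs : ∀ n, 0 < s n := fun n => lt_of_lt_of_le (by norm_num) (le_max_right _ _)
    have hkey : (1 + 1 / stepNorm δ n) * √(s n / s j) ≤ √(s (n + 1) / s j) := by
      apply Real.le_sqrt_of_sq_le
      rw [mul_pow, Real.sq_sqrt (by have := hs n; have := hs j; positivity), ← mul_div_assoc]
      apply div_le_div_of_nonneg_right _ (hs j).le
      have h1 : 1 / stepNorm δ n ≤ 1 / (2 * n + 1) := one_div_le_one_div_of_le (by positivity) hN'
      calc (1 + 1 / stepNorm δ n) ^ 2 * s n ≤ (1 + 1 / (2 * n + 1)) ^ 2 * s n := by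
            have := (hs n).le
            gcongr
        _ ≤ s (n + 1) := by
            refine le_trans ?_ (le_max_left _ _)
            rcases Nat.eq_zero_or_pos n with rfl | hn
            · simp [s]; norm_num
            · have hn' : (1 : ℝ) ≤ n := by exact_mod_cast hn
              have : s n = n := max_eq_left (by linarith)
              rw [this, show 1 + 1 / (2 * (n : ℝ) + 1) = (2 * n + 2) / (2 * n + 1) by
                field_simp; ring,
                div_pow, div_mul_eq_mul_div, div_le_iff₀ (by positivity)]
              push_cast
              nlinarith
    have hber : 1 + (p : ℝ) / stepNorm δ n ≤ (1 + 1 / stepNorm δ n) ^ p := by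
      have := one_add_mul_le_pow (a := 1 / stepNorm δ n) (by have := one_div_pos.2 hN; linarith) p
      calc _ = 1 + p * (1 / stepNorm δ n) := by ring
        _ ≤ _ := this
    calc (1 + p / stepNorm δ n) * avg δ n (fun g => rising (degBefore g n j + δ) p)
        ≤ (1 + 1 / stepNorm δ n) ^ p * (rising (1 + δ) p * √(s n / s j) ^ p) := by
          refine mul_le_mul hber ih (avg_nonneg fun g => rising_nonneg (by positivity) p)
            (by positivity)
      _ = rising (1 + δ) p * ((1 + 1 / stepNorm δ n) * √(s n / s j)) ^ p := by
          rw [mul_pow]; ring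
      _ ≤ rising (1 + δ) p * √(s (n + 1) / s j) ^ p := by
          have := rising_nonneg (show 0 ≤ 1 + (δ : ℝ) by positivity) p
          gcongr

lemma avg_rising_le' {j : ℕ} (hj : j ≤ n) (p : ℕ) :
    avg δ n (fun g => rising (degBefore g n j + δ) p) ≤
      (1 + δ + p) ^ p * (2 * √((n + 1) / (j + 1))) ^ p := by
  have hd : 0 ≤ (δ : ℝ) := δ.2
  refine (avg_rising_le hj p).trans ?_
  have h1 : √(max (n : ℝ) (1 / 4) / max (j : ℝ) (1 / 4)) ≤ 2 * √((n + 1) / (j + 1)) := by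
    rw [show (2 : ℝ) = √4 by rw [show (4 : ℝ) = 2 ^ 2 by norm_num, Real.sqrt_sq (by norm_num)],
      ← Real.sqrt_mul (by norm_num)]
    apply Real.sqrt_le_sqrt
    have hj0 : (0 : ℝ) ≤ j := by positivity
    have hn0 : (0 : ℝ) ≤ n := by positivity
    have ha : max (n : ℝ) (1 / 4) ≤ n + 1 := max_le (by linarith) (by linarith)
    have hb : ((j : ℝ) + 1) / 4 ≤ max (j : ℝ) (1 / 4) := by
      rcases Nat.eq_zero_or_pos j with rfl | h
      · simp
      · have : (1 : ℝ) ≤ j := by exact_mod_cast h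
        exact le_trans (by linarith) (le_max_left _ _)
    calc _ ≤ ((n : ℝ) + 1) / ((j + 1) / 4) := by gcongr
      _ = _ := by field_simp
  have h2 := rising_le_pow (show 0 ≤ 1 + (δ : ℝ) by positivity) p
  gcongr

/-- The degrees before the addition of vertex `i` are at most `M` times their typical order. -/
def DegOkAt (δ : ℝ≥0) (M : ℝ) (g : Attachments n) (i : ℕ) : Prop :=
  ∀ j ≤ i, (degBefore g i j + δ : ℝ) ≤ M * √((i + 1) / (j + 1))

/-- At all times the degrees are at most `M` times their typical order. -/
def DegOk (δ : ℝ≥0) (M : ℝ) (g : Attachments n) : Prop := ∀ i < n, DegOkAt δ M g i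

lemma degOk_extend {M : ℝ} (g : Attachments n) (x : Fin (n + 1)) :
    DegOk δ M (g.extend x) ↔ DegOk δ M g ∧ DegOkAt δ M g n := by
  have h : ∀ i ≤ n, (DegOkAt δ M (g.extend x) i ↔ DegOkAt δ M g i) := by
    intro i hi
    simp only [DegOkAt, degBefore_extend g x hi]
  constructor
  · exact fun hok => ⟨fun i hi => (h i hi.le).1 (hok i (by omega)),
      (h n le_rfl).1 (hok n (by omega))⟩
  · rintro ⟨h1, h2⟩ i hi
    rcases Nat.lt_succ_iff_lt_or_eq.1 hi with hi | rfl
    · exact (h i hi.le).2 (h1 i hi)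
    · exact (h i le_rfl).2 h2

-- Markov's inequality for the p-th rising factorial: M exceeds the p-th root of the moment bound by
-- the factor e², so each vertex fails with probability at most exp(-2p). A union bound over the n +
-- 1 vertices follows.
open Classical in
lemma avg_not_degOkAt_le (p : ℕ) :
    avg δ n (fun g => if DegOkAt δ (2 * (1 + δ + p) * Real.exp 2) g n then 0 else 1) ≤
      (n + 1) * Real.exp (-2 * p) := by
  have hd : 0 ≤ (δ : ℝ) := δ.2
  set M := 2 * (1 + δ + p) * Real.exp 2 with hM
  have hMpos : 0 < M := by positivity
  set w : ℕ → ℝ := fun j => M * √((n + 1) / (j + 1))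
  have hw : ∀ j, 0 < w j := fun j => by positivity
  have h1 : ∀ g : Attachments n, (if DegOkAt δ M g n then (0 : ℝ) else 1) ≤
      ∑ j ∈ Finset.range (n + 1), (1 / w j ^ p) * rising (degBefore g n j + δ) p := by
    intro g
    have hnn : ∀ j, 0 ≤ (1 / w j ^ p) * rising (degBefore g n j + δ) p := fun j =>
      mul_nonneg (by have := hw j; positivity) (rising_nonneg (by positivity) p)
    split_ifs with hok
    · exact Finset.sum_nonneg fun j _ => hnn j
    · unfold DegOkAt at hok
      push Not at hok
      obtain ⟨j, hj, hlt⟩ := hok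
      refine le_trans ?_ (Finset.single_le_sum (fun j _ => hnn j)
        (Finset.mem_range.2 (Nat.lt_succ_of_le hj)))
      rw [one_div_mul_eq_div, le_div_iff₀ (pow_pos (hw j) p), one_mul]
      exact (pow_le_pow_left₀ (hw j).le hlt.le p).trans (pow_le_rising (by positivity) p)
  refine (avg_mono h1).trans ?_
  rw [avg_sum]
  have h2 : ∀ j ∈ Finset.range (n + 1),
      avg δ n (fun g => (1 / w j ^ p) * rising (degBefore g n j + δ) p) ≤ Real.exp (-2 * p) := by
    intro j hj
    rw [avg_const_mul]
    have hq : 0 < √(((n : ℝ) + 1) / (j + 1)) := by positivity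
    calc _ ≤ (1 / w j ^ p) * ((1 + δ + p) ^ p * (2 * √((n + 1) / (j + 1))) ^ p) :=
          mul_le_mul_of_nonneg_left (avg_rising_le' (Nat.lt_succ_iff.1 (Finset.mem_range.1 hj)) p)
            (by have := hw j; positivity)
      _ = ((1 + δ + p) * (2 * √((n + 1) / (j + 1))) / w j) ^ p := by
          rw [div_pow, mul_pow (1 + (δ : ℝ) + p), one_div_mul_eq_div]
      _ = (Real.exp (-2)) ^ p := by
          congr 1
          simp only [w, hM]
          rw [Real.exp_neg]
          field_simp
      _ = _ := by rw [← Real.exp_nat_mul]; congr 1; ring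
  refine (Finset.sum_le_sum h2).trans ?_
  simp

open Classical in
/-- With high probability, the degrees are never much larger than their typical order. -/
lemma avg_not_degOk_le (p : ℕ) :
    avg δ n (fun g => if DegOk δ (2 * (1 + δ + p) * Real.exp 2) g then 0 else 1) ≤
      n ^ 2 * Real.exp (-2 * p) := by
  induction n with
  | zero => simp [DegOk, avg_const]
  | succ n ih =>
    rw [avg_succ]
    set M := 2 * (1 + δ + p) * Real.exp 2 with hM
    have h1 : ∀ g : Attachments n, (∑ x, (stepProb δ g x : ℝ) *
        if DegOk δ M (g.extend x) then (0 : ℝ) else 1) ≤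
        (if DegOk δ M g then (0 : ℝ) else 1) + if DegOkAt δ M g n then (0 : ℝ) else 1 := by
      intro g
      simp only [degOk_extend]
      rw [← Finset.sum_mul, sum_stepProb_real, one_mul]
      by_cases a : DegOk δ M g <;> by_cases b : DegOkAt δ M g n <;> simp [a, b]
    refine (avg_mono h1).trans ?_
    rw [avg_add]
    have h2 := avg_not_degOkAt_le (δ := δ) (n := n) p
    have h3 := Real.exp_pos (-2 * (p : ℝ))
    have h4 : (0 : ℝ) ≤ n := by positivity
    push_cast
    nlinarith

/-! ### The probability of given edges -/

lemma card_filter_div_le {m : ℕ} (hm : 0 < m) (b : ℕ) :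
    ((Finset.univ : Finset (Fin n)).filter fun x : Fin n => (x : ℕ) / m = b).card ≤ m := by
  refine (Finset.card_le_card_of_injOn (t := Finset.range m) (fun x : Fin n => (x : ℕ) % m)
    (fun x _ => by simpa using Nat.mod_lt _ hm) ?_).trans (Finset.card_range m).le
  intro x hx y hy hxy
  simp only [Finset.coe_filter, Finset.mem_univ, true_and, Set.mem_ofPred_eq] at hx hy hxy
  apply Fin.ext
  rw [← Nat.div_add_mod (x : ℕ) m, ← Nat.div_add_mod (y : ℕ) m, hx, hy, hxy]

/-- For a single vertex x the degree bound gives M √((n + 1) / (x + 1)) / (n + 1) = M / √((n + 1)(x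
+ 1)), and a block contains at most m vertices. -/
lemma sum_stepProb_block_le {M : ℝ} (hM : 0 ≤ M) {m : ℕ} (hm : 0 < m) {g : Attachments n}
    (hok : DegOkAt δ M g n) (b : ℕ) :
    (∑ x : Fin (n + 1), if (x : ℕ) / m = b then (stepProb δ g x : ℝ) else 0) ≤
      m * M / √(((n / m : ℕ) + 1) * (b + 1)) := by
  rw [← Finset.sum_filter]
  have h : ∀ x ∈ (Finset.univ : Finset (Fin (n + 1))).filter
      (fun x : Fin (n + 1) => (x : ℕ) / m = b),
      (stepProb δ g x : ℝ) ≤ M / √(((n / m : ℕ) + 1) * (b + 1)) := by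
    intro x hx
    simp only [Finset.mem_filter, Finset.mem_univ, true_and] at hx
    have h1 := hok x (Nat.lt_succ_iff.1 x.isLt)
    have h2 := stepNorm_ge δ n
    have hn : (0 : ℝ) ≤ n := by positivity
    have h3 : ((n / m : ℕ) : ℝ) ≤ n := by exact_mod_cast Nat.div_le_self n m
    have h4 : (b : ℝ) ≤ (x : ℕ) := by rw [← hx]; exact_mod_cast Nat.div_le_self x m
    rw [stepProb_eq]
    calc _ ≤ M * √((n + 1) / ((x : ℕ) + 1)) / (n + 1) := by
          gcongr
          linarith
      _ = M / √((n + 1) * ((x : ℕ) + 1)) := by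
          rw [Real.sqrt_div (by positivity), Real.sqrt_mul (by positivity)]
          have h5 : (n : ℝ) + 1 = √((n : ℝ) + 1) * √((n : ℝ) + 1) :=
            (Real.mul_self_sqrt (by positivity)).symm
          have h6 : 0 < √((n : ℝ) + 1) := by positivity
          have h7 : 0 < √(((x : ℕ) : ℝ) + 1) := by positivity
          rw [mul_div_assoc, div_div, mul_div_assoc']
          rw [div_eq_div_iff (by positivity) (by positivity)]
          linear_combination (-M * √(((x : ℕ) : ℝ) + 1)) * h5
      _ ≤ _ := by gcongr
  refine (Finset.sum_le_sum h).trans ?_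
  rw [Finset.sum_const, nsmul_eq_mul, mul_div_assoc]
  gcongr
  exact card_filter_div_le hm b

open Classical in
/-- The probability that the edges in `S` lead to given blocks, while all degrees are of the typical
order. -/
lemma avg_edges_le {M : ℝ} (hM : 0 ≤ M) {m : ℕ} (hm : 0 < m) (S : Finset ℕ) (φ : ℕ → ℕ) :
    avg δ n (fun g => if DegOk δ M g ∧ ∀ a : Fin n, (a : ℕ) ∈ S → (g a : ℕ) / m = φ a
      then 1 else 0) ≤
      ∏ i ∈ Finset.range n, if i ∈ S then m * M / √(((i / m : ℕ) + 1) * (φ i + 1)) else 1 := by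
  induction n with
  | zero => simp [DegOk, avg_const]
  | succ n ih =>
    rw [avg_succ, Finset.prod_range_succ, mul_comm]
    set W : ℝ := if n ∈ S then m * M / √(((n / m : ℕ) + 1) * (φ n + 1)) else 1
    have hW : 0 ≤ W := by simp only [W]; split_ifs <;> positivity
    refine le_trans ?_ (mul_le_mul_of_nonneg_left ih hW)
    rw [← avg_const_mul]
    refine avg_mono fun g => ?_
    have hext : ∀ x : Fin (n + 1),
        (∀ a : Fin (n + 1), (a : ℕ) ∈ S → ((g.extend x a : Fin _) : ℕ) / m = φ a) ↔
          (∀ a : Fin n, (a : ℕ) ∈ S → (g a : ℕ) / m = φ a) ∧ (n ∈ S → (x : ℕ) / m = φ n) := by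
      intro x
      rw [Fin.forall_fin_succ']
      simp only [extend_castSucc, extend_last, Fin.val_castSucc, Fin.val_last]
    simp only [degOk_extend, hext]
    by_cases hA : DegOk δ M g ∧ ∀ a : Fin n, (a : ℕ) ∈ S → (g a : ℕ) / m = φ a
    swap
    · rw [if_neg hA, mul_zero]
      refine (Finset.sum_eq_zero fun x _ => ?_).le
      rw [if_neg (by tauto), mul_zero]
    rw [if_pos hA, mul_one]
    by_cases hB : DegOkAt δ M g n
    swap
    · refine le_trans (le_of_eq (Finset.sum_eq_zero fun x _ => ?_)) hW
      rw [if_neg (by tauto), mul_zero]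
    by_cases hS : n ∈ S
    · simp only [W, if_pos hS]
      refine le_trans (Finset.sum_le_sum fun x _ => ?_) (sum_stepProb_block_le hM hm hB (φ n))
      by_cases hx : (x : ℕ) / m = φ n
      · rw [if_pos hx]
        split_ifs <;> simp
      · rw [if_neg (fun h => hx (h.2.2 hS)), if_neg hx, mul_zero]
    · simp only [W, if_neg hS]
      refine (Finset.sum_le_sum fun x _ => mul_le_of_le_one_right NNReal.zero_le_coe ?_).trans
        (sum_stepProb_real (δ := δ) g).le
      split_ifs <;> norm_num

/-! ### Lower bounds for degrees -/

/-- With X = D + δ ≥ 1, a growth step multiplies 1 / X on average by 1 - X / ((X + 1) N) ≤ 1 - c /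
(n + 1), from X / (X + 1) ≥ 1/2 and N ≤ (n + 1)(2 + δ). Markov's inequality for 1 / X then shows
that old vertices rarely have small degree. -/
lemma avg_inv_degBefore_le {j : ℕ} (hj : j ≤ n) :
    avg δ n (fun g => 1 / (degBefore g n j + δ : ℝ)) ≤
      ((j + 1 : ℝ) / (n + 1)) ^ (1 / (2 * (2 + δ)) : ℝ) := by
  have hd : 0 ≤ (δ : ℝ) := δ.2
  set c : ℝ := 1 / (2 * (2 + δ)) with hc
  have hc0 : 0 < c := by positivity
  have hc1 : c ≤ 1 := by rw [hc, div_le_one (by positivity)]; linarith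
  induction n, hj using Nat.le_induction with
  | base =>
    rw [div_self (by positivity), Real.one_rpow]
    simp only [degBefore_of_le _ (le_refl j), Nat.cast_one, avg_const]
    rw [div_le_one (by positivity)]
    linarith
  | succ n hj ih =>
    have hN := stepNorm_pos δ n
    rw [avg_succ]
    have hfac : 0 ≤ 1 - c / (n + 1) := by
      have : c / (n + 1) ≤ c := div_le_self hc0.le (by linarith [(Nat.cast_nonneg n : (0 : ℝ) ≤ n)])
      linarith
    have e : ∀ g : Attachments n, (∑ x, (stepProb δ g x : ℝ) *
        (1 / (degBefore (g.extend x) (n + 1) j + δ : ℝ))) ≤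
        (1 - c / (n + 1)) * (1 / (degBefore g n j + δ : ℝ)) := by
      intro g
      rw [sum_step_degBefore g hj fun D => 1 / (D + δ : ℝ)]
      have hX : (1 : ℝ) ≤ degBefore g n j + δ := by
        have : (1 : ℝ) ≤ degBefore g n j := by exact_mod_cast one_le_degBefore g n j
        linarith
      push_cast
      rw [show (degBefore g n j : ℝ) + 1 + δ = degBefore g n j + δ + 1 by ring]
      set X := (degBefore g n j + δ : ℝ)
      have hNle : stepNorm δ n ≤ (n + 1) * (2 + δ) := by unfold stepNorm; nlinarith
      have h1 : c / (n + 1) ≤ X / ((X + 1) * stepNorm δ n) := by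
        rw [hc, div_div, div_le_div_iff₀ (by positivity) (by positivity), one_mul]
        calc (X + 1) * stepNorm δ n ≤ (2 * X) * ((n + 1) * (2 + δ)) := by
              gcongr; linarith
          _ = _ := by ring
      calc 1 / X + X / stepNorm δ n * (1 / (X + 1) - 1 / X)
          = (1 - X / ((X + 1) * stepNorm δ n)) * (1 / X) := by field_simp; ring
        _ ≤ _ := by gcongr
    refine (avg_mono e).trans ?_
    rw [avg_const_mul]
    refine (mul_le_mul_of_nonneg_left ih hfac).trans ?_
    push_cast
    have hn : (0 : ℝ) < (n : ℝ) + 1 := by positivity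
    have hn2 : (0 : ℝ) < (n : ℝ) + 1 + 1 := by positivity
    -- Bernoulli's inequality with exponent c ≤ 1; combined with the factor 1 - c / (n + 1) it
    -- leaves a product at most 1.
    have hb : (((n : ℝ) + 1 + 1) / (n + 1)) ^ c ≤ 1 + c / (n + 1) := by
      have := rpow_one_add_le_one_add_mul_self (s := 1 / ((n : ℝ) + 1))
        (by have : (0 : ℝ) ≤ 1 / ((n : ℝ) + 1) := by positivity
            linarith) hc0.le hc1
      calc _ = (1 + 1 / ((n : ℝ) + 1)) ^ c := by congr 1; field_simp
        _ ≤ _ := this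
        _ = _ := by ring
    have hsplit : ((j + 1 : ℝ) / (n + 1)) ^ c =
        ((j + 1 : ℝ) / (n + 1 + 1)) ^ c * (((n : ℝ) + 1 + 1) / (n + 1)) ^ c := by
      rw [← Real.mul_rpow (by positivity) (by positivity)]
      congr 1
      field_simp
    rw [hsplit]
    have hp : 0 ≤ ((j + 1 : ℝ) / (n + 1 + 1)) ^ c := by positivity
    calc _ ≤ (1 - c / (n + 1)) * (((j + 1 : ℝ) / (n + 1 + 1)) ^ c * (1 + c / (n + 1))) := by gcongr
      _ = ((j + 1 : ℝ) / (n + 1 + 1)) ^ c * (1 - (c / (n + 1)) ^ 2) := by ring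
      _ ≤ _ := mul_le_of_le_one_right hp (by nlinarith [sq_nonneg (c / ((n : ℝ) + 1))])

end Degrees

/-! ### Sequences of vertices in which no vertex but one appears exactly once -/

section Covering

variable {P : Type} [Fintype P] {t : ℕ}

/-- The number of times that `y` appears in `w`. -/
def mult (w : P → Fin t) (y : Fin t) : ℕ := (Finset.univ.filter fun p => w p = y).card

/-- The vertex `v` appears at least `κ` times in `w`, and no other vertex appears exactly once. -/
def Covering (κ : ℕ) (v : Fin t) (w : P → Fin t) : Prop :=
  κ ≤ mult w v ∧ ∀ y, y ≠ v → mult w y ≠ 1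

/-- The enumeration is padded to length s with a vertex of weight 1, which leaves the product of the
weights unchanged. -/
lemma exists_enumeration (f : Fin t → ℝ) (z₀ : Fin t) (hz₀ : f z₀ = 1) (Y : Finset (Fin t)) {s : ℕ}
    (hY : Y.card ≤ s) :
    ∃ z : Fin s → Fin t, (∀ y ∈ Y, ∃ a, z a = y) ∧ ∏ a, f (z a) = ∏ y ∈ Y, f y := by
  induction Y using Finset.induction_on generalizing s with
  | empty => exact ⟨fun _ => z₀, by simp, by simp [hz₀]⟩
  | insert y Y hy ih =>
    rw [Finset.card_insert_of_notMem hy] at hY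
    obtain ⟨s, rfl⟩ := Nat.exists_eq_add_of_le' (show 1 ≤ s by omega)
    obtain ⟨z, hz1, hz2⟩ := ih (s := s) (by omega)
    refine ⟨Fin.cons y z, fun y' hy' => ?_, ?_⟩
    · rcases Finset.mem_insert.1 hy' with rfl | h
      · exact ⟨0, rfl⟩
      · obtain ⟨a, ha⟩ := hz1 y' h
        exact ⟨a.succ, by simpa using ha⟩
    · rw [Fin.prod_univ_succ, Finset.prod_insert hy]
      simp [hz2]

lemma prod_eq_prod_pow_mult (w : P → Fin t) (f : Fin t → ℝ) :
    ∏ p, f (w p) = ∏ y, f y ^ mult w y := by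
  rw [← Finset.prod_fiberwise Finset.univ w]
  refine Finset.prod_congr rfl fun y _ => ?_
  rw [Finset.prod_congr rfl fun p hp => by rw [(Finset.mem_filter.1 hp).2], Finset.prod_const]
  rfl

-- At most 2s places hold at most s vertices other than v, since each occurs at least twice. The
-- code lists these vertices and says which one, or v, stands at each place. Two or more factors 1 /
-- √(y + 1) are together at most 1 / (y + 1).
open Classical in
lemma Covering.exists_coding {s κ : ℕ} (hP : Fintype.card P ≤ 2 * s) {v : Fin t} {w : P → Fin t}
    (hw : Covering κ v w) :
    ∃ q : (P → Option (Fin s)) × (Fin s → Fin t), (∀ p, w p = (q.1 p).elim v q.2) ∧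
      ∏ p, 1 / √((w p : ℝ) + 1) ≤ (1 / √((v : ℝ) + 1)) ^ κ * ∏ a, 1 / ((q.2 a : ℝ) + 1) := by
  have ht : 0 < t := Nat.zero_lt_of_lt v.isLt
  set Y := (Finset.univ.erase v).filter fun y => mult w y ≠ 0
  have hsum : ∑ y, mult w y = Fintype.card P := by
    rw [← Finset.card_univ, Finset.card_eq_sum_card_fiberwise (t := Finset.univ) (f := w)
      (fun _ _ => by simp)]
    rfl
  have hYc : Y.card ≤ s := by
    have h1 : ∑ _y ∈ Y, 2 ≤ ∑ y ∈ Y, mult w y := by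
      refine Finset.sum_le_sum fun y hy => ?_
      simp only [Y, Finset.mem_filter, Finset.mem_erase] at hy
      have := hw.2 y hy.1.1
      omega
    have h2 : ∑ y ∈ Y, mult w y ≤ ∑ y, mult w y :=
      Finset.sum_le_sum_of_subset (Finset.subset_univ _)
    rw [Finset.sum_const, smul_eq_mul] at h1
    omega
  obtain ⟨z, hz1, hz2⟩ := exists_enumeration (fun y => 1 / ((y : ℝ) + 1)) ⟨0, ht⟩ (by simp) Y hYc
  have hσ : ∀ p, ∃ o : Option (Fin s), w p = o.elim v z := by
    intro p
    by_cases hp : w p = v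
    · exact ⟨none, hp⟩
    · have : w p ∈ Y := by
        simp only [Y, Finset.mem_filter, Finset.mem_erase, Finset.mem_univ, and_true]
        refine ⟨hp, Finset.card_ne_zero_of_mem (a := p) (by simp)⟩
      obtain ⟨a, ha⟩ := hz1 _ this
      exact ⟨some a, ha.symm⟩
  choose σ hσ using hσ
  refine ⟨(σ, z), hσ, ?_⟩
  rw [hz2, prod_eq_prod_pow_mult w fun y => 1 / √((y : ℝ) + 1),
    ← Finset.mul_prod_erase _ _ (Finset.mem_univ v), Finset.prod_filter]
  have hb : ∀ y : Fin t, 1 / √((y : ℝ) + 1) ≤ 1 := fun y => by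
    rw [div_le_one (by positivity)]
    exact Real.one_le_sqrt.2 (by linarith [(Nat.cast_nonneg (y : ℕ) : (0 : ℝ) ≤ (y : ℕ))])
  refine mul_le_mul (pow_le_pow_of_le_one (by positivity) (hb v) hw.1)
    (Finset.prod_le_prod (fun y _ => by positivity) fun y hy => ?_)
    (Finset.prod_nonneg fun y _ => by positivity) (by positivity)
  have hy1 := hw.2 y (Finset.ne_of_mem_erase hy)
  split_ifs with h0
  · calc _ ≤ (1 / √((y : ℝ) + 1)) ^ 2 := pow_le_pow_of_le_one (by positivity) (hb y) (by omega)
      _ = _ := by rw [div_pow, Real.sq_sqrt (by positivity), one_pow]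
  · push Not at h0
    rw [h0, pow_zero]

-- A covering sequence is determined by its code, so the sum is bounded by one over all codes: (s +
-- 1) ^ (2s) bounds the number of patterns, and s free vertices give s harmonic sums.
open Classical in
lemma sum_covering_le [DecidableEq P] {s κ : ℕ} (hP : Fintype.card P ≤ 2 * s) (v : Fin t) :
    (∑ w : P → Fin t, if Covering κ v w then ∏ p, 1 / √((w p : ℝ) + 1) else 0) ≤
      (s + 1) ^ (2 * s) * (∑ y : Fin t, 1 / ((y : ℝ) + 1)) ^ s * (1 / √((v : ℝ) + 1)) ^ κ := by
  set A : Finset (P → Fin t) := Finset.univ.filter fun w => Covering κ v w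
  set U : (P → Option (Fin s)) × (Fin s → Fin t) → ℝ := fun q =>
    (1 / √((v : ℝ) + 1)) ^ κ * ∏ a, 1 / ((q.2 a : ℝ) + 1)
  have hU : ∀ q, 0 ≤ U q := fun q => by positivity
  have hex : ∀ w : P → Fin t, ∃ q : (P → Option (Fin s)) × (Fin s → Fin t), Covering κ v w →
      (∀ p, w p = (q.1 p).elim v q.2) ∧ ∏ p, 1 / √((w p : ℝ) + 1) ≤ U q := by
    intro w
    by_cases hw : Covering κ v w
    · obtain ⟨q, hq⟩ := hw.exists_coding hP
      exact ⟨q, fun _ => hq⟩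
    · exact ⟨(fun _ => none, fun _ => v), fun h => absurd h hw⟩
  choose ψ hψ using hex
  have hinj : Set.InjOn ψ A := by
    intro w hw w' hw' he
    simp only [A, Finset.coe_filter, Finset.mem_univ, true_and, Set.mem_ofPred_eq] at hw hw'
    funext p
    rw [(hψ w hw).1 p, (hψ w' hw').1 p, he]
  rw [← Finset.sum_filter]
  calc ∑ w ∈ A, ∏ p, 1 / √((w p : ℝ) + 1) ≤ ∑ w ∈ A, U (ψ w) :=
        Finset.sum_le_sum fun w hw => (hψ w (Finset.mem_filter.1 hw).2).2
    _ = ∑ q ∈ A.image ψ, U q := (Finset.sum_image hinj).symm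
    _ ≤ ∑ q, U q := Finset.sum_le_sum_of_subset_of_nonneg (Finset.subset_univ _) fun q _ _ => hU q
    _ = (s + 1) ^ (Fintype.card P) * ((1 / √((v : ℝ) + 1)) ^ κ *
          (∑ y : Fin t, 1 / ((y : ℝ) + 1)) ^ s) := by
        rw [Fintype.sum_prod_type]
        simp only [U]
        rw [Finset.sum_const, ← Finset.mul_sum,
          ← Fintype.sum_pow fun y : Fin t => 1 / ((y : ℝ) + 1), Finset.card_univ,
          Fintype.card_fun, Fintype.card_option, Fintype.card_fin, nsmul_eq_mul]
        push_cast
        rfl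
    _ ≤ (s + 1) ^ (2 * s) * ((1 / √((v : ℝ) + 1)) ^ κ *
          (∑ y : Fin t, 1 / ((y : ℝ) + 1)) ^ s) := by
        have : 0 ≤ ∑ y : Fin t, 1 / ((y : ℝ) + 1) := Finset.sum_nonneg fun y _ => by positivity
        gcongr
        linarith [(Nat.cast_nonneg s : (0 : ℝ) ≤ s)]
    _ = _ := by ring

end Covering

/-! ### The expected number of small leafless subgraphs -/

section Subgraphs

variable {δ : ℝ≥0} {m t s κ : ℕ}

/-- The far end, in `PA_t(m, δ)`, of the edge `a`. -/
def target {m t : ℕ} (g : Attachments (t * m)) (a : Fin (t * m)) : Fin t :=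
  (paGraph m t g).ends a true

lemma paGraph_ends_false (g : Attachments (t * m)) (a : Fin (t * m)) :
    (paGraph m t g).ends a false = a.divNat := by
  simp [paGraph, Multigraph.contract, attachmentGraph]

lemma val_target (g : Attachments (t * m)) (a : Fin (t * m)) :
    (target g a : ℕ) = (g a : ℕ) / m := by
  simp [target, paGraph, Multigraph.contract, attachmentGraph]

open Classical in
/-- The sequences of `s` distinct edges, together with their far ends, that form a subgraph in which
`v` has degree at least `κ` and no other vertex is a leaf. -/
noncomputable def leaflessTuples (g : Attachments (t * m)) (s κ : ℕ) (v : Fin t) :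
    Finset ((Fin s → Fin (t * m)) × (Fin s → Fin t)) :=
  Finset.univ.filter fun q => Function.Injective q.1 ∧
    Covering κ v (Sum.elim (fun a => (q.1 a).divNat) q.2) ∧ ∀ a, target g (q.1 a) = q.2 a

/-- Listing both ends of every edge of F turns degrees in F into multiplicities in the list. -/
lemma exists_leaflessTuple (g : Attachments (t * m)) {F : Finset (Fin (t * m))} {v : Fin t}
    (hv : κ ≤ (paGraph m t g).degIn F v) (hy : ∀ y, y ≠ v → (paGraph m t g).degIn F y ≠ 1) :
    ∃ q ∈ leaflessTuples g F.card κ v, ∀ e ∈ F, ∃ a, q.1 a = e := by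
  classical
  set i : Fin F.card → Fin (t * m) := fun a => F.equivFin.symm a
  have hmult : ∀ y, mult (Sum.elim (fun a => (i a).divNat) fun a => target g (i a)) y =
      (paGraph m t g).degIn F y := by
    intro y
    unfold mult Multigraph.degIn
    rw [Finset.card_filter, Fintype.sum_sum_type, ← Finset.sum_add_distrib, ← Finset.sum_coe_sort F,
      ← Equiv.sum_comp F.equivFin.symm]
    refine Finset.sum_congr rfl fun a _ => ?_
    simp only [Sum.elim_inl, Sum.elim_inr, Multigraph.incidence, paGraph_ends_false, i]
    rw [add_comm]
    rfl
  refine ⟨(i, fun a => target g (i a)), ?_, fun e he => ⟨F.equivFin ⟨e, he⟩, by simp [i]⟩⟩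
  simp only [leaflessTuples, Finset.mem_filter, Finset.mem_univ, true_and, implies_true, and_true]
  refine ⟨fun a b hab => F.equivFin.symm.injective (Subtype.ext hab), ?_, fun y hne => ?_⟩
  · rw [hmult]; exact hv
  · rw [hmult]; exact hy y hne

-- The bound of `avg_edges_le` distributes over the 2s edge ends, because √((i + 1)(j + 1)) factors.
open Classical in
lemma avg_realized_le {M : ℝ} (hM : 0 ≤ M) (hm : 0 < m) {i : Fin s → Fin (t * m)}
    (hi : Function.Injective i) (φ : Fin s → Fin t) :
    avg δ (t * m) (fun g => if DegOk δ M g ∧ ∀ a, target g (i a) = φ a then 1 else 0) ≤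
      (m * M) ^ s * ∏ p, 1 / √(((Sum.elim (fun a => (i a).divNat) φ p : Fin t) : ℝ) + 1) := by
  set S : Finset ℕ := Finset.univ.image fun a => (i a : ℕ)
  have hi' : Function.Injective fun a => (i a : ℕ) := fun a b h => hi (Fin.ext h)
  set φ' : ℕ → ℕ := Function.extend (fun a => (i a : ℕ)) (fun a => (φ a : ℕ)) 0
  have hφ' : ∀ a, φ' (i a) = φ a := fun a => hi'.extend_apply _ _ a
  have h1 : ∀ g : Attachments (t * m),
      (if DegOk δ M g ∧ ∀ a, target g (i a) = φ a then (1 : ℝ) else 0) ≤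
        if DegOk δ M g ∧ ∀ a : Fin (t * m), (a : ℕ) ∈ S → (g a : ℕ) / m = φ' a then 1 else 0 := by
    intro g
    by_cases hg : DegOk δ M g ∧ ∀ a, target g (i a) = φ a
    · rw [if_pos hg, if_pos]
      refine ⟨hg.1, fun a ha => ?_⟩
      obtain ⟨b, -, hb⟩ := Finset.mem_image.1 ha
      obtain rfl : i b = a := Fin.ext hb
      rw [hφ', ← hg.2 b, val_target]
    · rw [if_neg hg]
      split_ifs <;> norm_num
  refine (avg_mono h1).trans ((avg_edges_le hM hm S φ').trans (le_of_eq ?_))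
  have hS : S ⊆ Finset.range (t * m) := by
    intro a ha
    obtain ⟨b, -, rfl⟩ := Finset.mem_image.1 ha
    exact Finset.mem_range.2 (i b).isLt
  rw [Finset.prod_ite_mem, Finset.inter_eq_right.2 hS, Finset.prod_image fun a _ b _ h => hi' h,
    Fintype.prod_sum_type, ← Finset.prod_mul_distrib]
  have h2 : ((m : ℝ) * M) ^ s = ∏ _a : Fin s, (m : ℝ) * M := by simp
  rw [h2, ← Finset.prod_mul_distrib]
  refine Finset.prod_congr rfl fun a _ => ?_
  rw [hφ', Real.sqrt_mul (by positivity)]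
  simp only [Sum.elim_inl, Sum.elim_inr, Fin.coe_divNat]
  field_simp

open Classical in
lemma sum_divNat (F : (Fin s → Fin t) → ℝ) :
    ∑ i : Fin s → Fin (t * m), F (fun a => (i a).divNat) = m ^ s * ∑ x, F x := by
  rw [← Equiv.sum_comp ((Equiv.arrowProdEquivProdArrow (Fin s) (fun _ => Fin t)
    (fun _ => Fin m)).symm.trans (Equiv.arrowCongr (Equiv.refl _) finProdFinEquiv)),
    Fintype.sum_prod_type, Finset.mul_sum]
  refine Finset.sum_congr rfl fun x _ => ?_
  have : ∀ c : Fin s → Fin m, F (fun a => (((Equiv.arrowProdEquivProdArrow (Fin s) (fun _ => Fin t)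
      (fun _ => Fin m)).symm.trans (Equiv.arrowCongr (Equiv.refl _) finProdFinEquiv)) (x, c)
        a).divNat) = F x := by
    intro c
    congr 1
    funext a
    exact congrArg Prod.fst (finProdFinEquiv.symm_apply_apply (x a, c a))
  rw [Finset.sum_congr rfl fun c _ => this c, Finset.sum_const, Finset.card_univ, Fintype.card_fun,
    Fintype.card_fin, Fintype.card_fin, nsmul_eq_mul]
  push_cast
  rfl

open Classical in
lemma sum_sumElim_divNat (W : (Fin s ⊕ Fin s → Fin t) → ℝ) :
    ∑ q : (Fin s → Fin (t * m)) × (Fin s → Fin t), W (Sum.elim (fun a => (q.1 a).divNat) q.2) =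
      m ^ s * ∑ w, W w := by
  rw [Fintype.sum_prod_type, Finset.sum_comm,
    Finset.sum_congr rfl fun φ _ => sum_divNat (m := m) fun x => W (Sum.elim x φ), ← Finset.mul_sum,
    Finset.sum_comm, ← Fintype.sum_prod_type']
  congr 1
  exact Equiv.sum_comp (Equiv.sumArrowEquivProdArrow (Fin s) (Fin s) (Fin t)).symm W

open Classical in
lemma card_leaflessTuples (g : Attachments (t * m)) (v : Fin t) (M : ℝ) :
    (if DegOk δ M g then ((leaflessTuples g s κ v).card : ℝ) else 0) =
      ∑ q : (Fin s → Fin (t * m)) × (Fin s → Fin t),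
        (if Function.Injective q.1 ∧ Covering κ v (Sum.elim (fun a => (q.1 a).divNat) q.2)
          then (1 : ℝ) else 0) *
        if DegOk δ M g ∧ ∀ a, target g (q.1 a) = q.2 a then 1 else 0 := by
  by_cases hg : DegOk δ M g
  · rw [if_pos hg, leaflessTuples, Finset.card_filter]
    push_cast
    refine Finset.sum_congr rfl fun q _ => ?_
    rw [ite_zero_mul_ite_zero, mul_one]
    exact if_congr (by simp only [hg, true_and, and_assoc]) rfl rfl
  · rw [if_neg hg]
    refine (Finset.sum_eq_zero fun q _ => ?_).symm
    rw [if_neg (c := DegOk δ M g ∧ _) (fun h => hg h.1), mul_zero]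

open Classical in
/-- First moment bound for small leafless subgraphs. -/
lemma avg_card_leaflessTuples_le {M : ℝ} (hM : 0 ≤ M) (hm : 0 < m) (v : Fin t) :
    avg δ (t * m) (fun g => if DegOk δ M g then ((leaflessTuples g s κ v).card : ℝ) else 0) ≤
      (m * (m * M)) ^ s * ((s + 1) ^ (2 * s) * (∑ y : Fin t, 1 / ((y : ℝ) + 1)) ^ s *
        (1 / √((v : ℝ) + 1)) ^ κ) := by
  set W : (Fin s ⊕ Fin s → Fin t) → ℝ := fun w =>
    if Covering κ v w then ∏ p, 1 / √((w p : ℝ) + 1) else 0 with hWdef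
  have hW : ∀ w, 0 ≤ W w := fun w => by simp only [W]; split_ifs <;> positivity
  rw [funext fun g => card_leaflessTuples g v M, avg_sum]
  have h2 : ∀ q : (Fin s → Fin (t * m)) × (Fin s → Fin t),
      avg δ (t * m) (fun g =>
        (if Function.Injective q.1 ∧ Covering κ v (Sum.elim (fun a => (q.1 a).divNat) q.2)
          then (1 : ℝ) else 0) *
        if DegOk δ M g ∧ ∀ a, target g (q.1 a) = q.2 a then 1 else 0) ≤
      (m * M) ^ s * W (Sum.elim (fun a => (q.1 a).divNat) q.2) := by
    intro q
    rw [avg_const_mul]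
    by_cases hq : Function.Injective q.1 ∧ Covering κ v (Sum.elim (fun a => (q.1 a).divNat) q.2)
    · rw [if_pos hq, one_mul]
      simp only [W, if_pos hq.2]
      exact avg_realized_le hM hm hq.1 q.2
    · rw [if_neg hq, zero_mul]
      exact mul_nonneg (by positivity) (hW _)
  refine (Finset.sum_le_sum fun q _ => h2 q).trans ?_
  rw [← Finset.mul_sum, sum_sumElim_divNat, ← mul_assoc, ← mul_pow, mul_comm (m * M : ℝ)]
  have hcard : Fintype.card (Fin s ⊕ Fin s) ≤ 2 * s := by
    rw [Fintype.card_sum, Fintype.card_fin]; omega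
  exact mul_le_mul_of_nonneg_left (sum_covering_le hcard v) (by positivity)

/-! ### Tangled half-edges are rare -/

/-- Every tangled half-edge at v belongs to one of the s edges, hence 2s half-edges, of a leafless
tuple. -/
lemma card_tangledAt_le (g : Attachments (t * m)) (ℓ : ℕ) (v : Fin t) :
    (tangledAt (paGraph m t g) ℓ v).card ≤
      ∑ s ∈ Finset.range (ℓ + 1), (leaflessTuples g s 1 v).card * (2 * s) := by
  classical
  have hsub : tangledAt (paGraph m t g) ℓ v ⊆ (Finset.range (ℓ + 1)).biUnion fun s =>
      (leaflessTuples g s 1 v).biUnion fun q => (Finset.univ.image q.1) ×ˢ Finset.univ := by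
    intro h hh
    obtain ⟨hb, F, hF, hm, hy⟩ := Finset.mem_filter.1 hh
    rw [Multigraph.mem_halfEdges] at hb
    rw [hb] at hy
    have h1 : 1 ≤ (paGraph m t g).degIn F v := by
      rw [← Finset.card_singleton h]
      exact Multigraph.card_le_degIn (by simp [hm, hb])
    obtain ⟨q, hq, hq'⟩ := exists_leaflessTuple g h1 hy
    obtain ⟨a, ha⟩ := hq' _ hm
    simp only [Finset.mem_biUnion, Finset.mem_range, Finset.mem_product, Finset.mem_image,
      Finset.mem_univ, true_and, and_true]
    exact ⟨F.card, by omega, q, hq, a, ha⟩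
  refine (Finset.card_le_card hsub).trans (Finset.card_biUnion_le.trans
    (Finset.sum_le_sum fun s _ => Finset.card_biUnion_le.trans ?_))
  refine (Finset.sum_le_card_nsmul _ _ (2 * s) fun q _ => ?_).trans (by simp)
  rw [Finset.card_product, Finset.card_univ, Fintype.card_bool, mul_comm]
  exact Nat.mul_le_mul_left 2 (Finset.card_image_le.trans (by simp))

/-- The witnesses of three tangled half-edges have a union in which v has degree at least 3. Degree
3 costs (v + 1) ^ (-3/2), which is summable over v. -/
lemma exists_leaflessTuple_of_card_tangledAt (g : Attachments (t * m)) {ℓ : ℕ} {v : Fin t}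
    (h : 2 < (tangledAt (paGraph m t g) ℓ v).card) :
    1 ≤ ∑ s ∈ Finset.range (3 * ℓ + 1), (leaflessTuples g s 3 v).card := by
  classical
  obtain ⟨h1, h2, h3, m1, m2, m3, e1, e2, e3⟩ := Finset.two_lt_card_iff.1 h
  simp only [tangledAt, Finset.mem_filter, Multigraph.mem_halfEdges] at m1 m2 m3
  obtain ⟨F, hF, hv, hy⟩ := Multigraph.exists_leafless_of_three_tangled m1.2 m2.2 m3.2 e1 e2 e3
    m1.1 m2.1 m3.1
  obtain ⟨q, hq, -⟩ := exists_leaflessTuple g hv hy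
  exact le_trans (Finset.card_pos.2 ⟨q, hq⟩) (Finset.single_le_sum
    (f := fun s => (leaflessTuples g s 3 v).card) (fun _ _ => Nat.zero_le _)
    (Finset.mem_range.2 (by omega)))

end Subgraphs

/-! ### The probability of a red vertex on the preferential attachment graph -/

section Quenched

variable {δ : ℝ≥0} {m t : ℕ}

/-- The degree of the first of the m vertices merged into u already bounds the degree of u from
below. -/
lemma degBefore_le_degree (hm : 0 < m) (g : Attachments (t * m)) (u : Fin t) :
    degBefore g (t * m) (m * u) ≤ (paGraph m t g).degree u := by
  have hlt : m * (u : ℕ) < t * m := by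
    rw [mul_comm t]; exact Nat.mul_lt_mul_of_pos_left u.isLt hm
  have h := degree_attachmentGraph g ⟨m * u, hlt⟩
  rw [← h]
  refine Finset.card_le_card fun e he => ?_
  rw [Multigraph.mem_halfEdges] at he ⊢
  have : (paGraph m t g).base e = ((attachmentGraph g).base e).divNat := rfl
  rw [this, he]
  ext
  simp [hm]

lemma le_degree_paGraph (g : Attachments (t * m)) (u : Fin t) :
    m ≤ (paGraph m t g).degree u := by
  classical
  have h : (Finset.univ.image fun c : Fin m => (finProdFinEquiv (u, c), false)) ⊆
      (paGraph m t g).halfEdges u := by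
    intro e he
    obtain ⟨c, -, rfl⟩ := Finset.mem_image.1 he
    rw [Multigraph.mem_halfEdges]
    change (paGraph m t g).ends _ false = u
    rw [paGraph_ends_false]
    exact congrArg Prod.fst (finProdFinEquiv.symm_apply_apply (u, c))
  have h2 := Finset.card_le_card h
  rw [Finset.card_image_of_injective, Finset.card_univ, Fintype.card_fin] at h2
  · exact h2
  · intro c c' hc
    simpa using hc

lemma card_tangledAt_mul_le (g : Attachments (t * m)) {k ℓ : ℕ} {K : ℝ} (hK : 0 < K) {u : Fin t}
    (hD : K ≤ (paGraph m t g).degree u) :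
    ((tangledAt (paGraph m t g) ℓ u).card : ℝ) * ((k : ℝ) / ((paGraph m t g).degree u : ℝ)) ≤
      ∑ s ∈ Finset.range (ℓ + 1), (2 * s * (k / K)) * ((leaflessTuples g s 1 u).card : ℝ) := by
  have hT : ((tangledAt (paGraph m t g) ℓ u).card : ℝ) ≤
      ∑ s ∈ Finset.range (ℓ + 1), ((leaflessTuples g s 1 u).card : ℝ) * (2 * s) := by
    exact_mod_cast card_tangledAt_le g ℓ u
  have hk : (k : ℝ) / ((paGraph m t g).degree u : ℝ) ≤ k / K :=
    div_le_div_of_nonneg_left (Nat.cast_nonneg k) hK hD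
  refine (mul_le_mul hT hk (div_nonneg (Nat.cast_nonneg _) (Nat.cast_nonneg _))
    ((Nat.cast_nonneg _).trans hT)).trans (le_of_eq ?_)
  rw [Finset.sum_mul]
  exact Finset.sum_congr rfl fun s _ => by ring

/-- The growth factor in the bounds for the number of small leafless subgraphs. -/
noncomputable def tupleBound (m t : ℕ) (M : ℝ) (s : ℕ) : ℝ :=
  (m * (m * M)) ^ s * ((s + 1) ^ (2 * s) * (∑ y : Fin t, 1 / ((y : ℝ) + 1)) ^ s)

open Classical in
/-- A bound for the probability that some vertex is red, given the graph. -/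
noncomputable def graphBound (δ : ℝ≥0) (k C : ℕ) (M K x : ℝ) (n : ℕ)
    (g : Attachments (t * m)) : ℝ :=
  (if DegOk δ M g then 0 else 1) +
  (∑ u ∈ (Finset.univ : Finset (Fin t)).filter (fun u : Fin t => (u : ℕ) < C),
    (K + δ) * (1 / (degBefore g (t * m) (m * u) + δ : ℝ))) +
  (∑ v ∈ (Finset.univ : Finset (Fin t)).filter (fun v : Fin t => ¬ (v : ℕ) < C),
    ∑ s ∈ Finset.range (3 * (2 * n + 1) + 1),
      if DegOk δ M g then ((leaflessTuples g s 3 v).card : ℝ) else 0) +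
  (∑ u ∈ (Finset.univ : Finset (Fin t)).filter (fun u : Fin t => (u : ℕ) < C),
    ∑ s ∈ Finset.range (2 * n + 1 + 1),
      (2 * s * (k / K)) * if DegOk δ M g then ((leaflessTuples g s 1 u).card : ℝ) else 0) +
  2 * (t * m) * x

-- Each of the first three summands is at least 1 on its bad event: a degree is too large, a core
-- vertex has a first constituent of degree below K, or (with degrees under control) a vertex
-- outside the core has three tangled half-edges. There the trivial bound 1 suffices. Elsewhere
-- `protocolLaw_red_le` applies and yields the last two summands.
open Classical in
lemma protocolLaw_red_le_graphBound (hm : 0 < m) {r : ℕ} (hr : 2 ≤ r) {α : unitInterval}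
    {k n C : ℕ} {M K : ℝ} (hK : 0 < K)
    (hx : ∀ j, 0 ≤ redBound r α j ∧ redBound r α j ≤ 1 / 2)
    (hodd : ∀ D, m ≤ D → ∃ s, r ≤ s ∧ pollSize k D = 2 * s + 1) (g : Attachments (t * m)) :
    (protocolLaw (paGraph m t g) k α
      {ω | ∃ v, colourAt (paGraph m t g) ω.1 ω.2 (n + 1) v = .red}).toReal ≤
      graphBound δ k C M K (redBound r α n) n g := by
  have hδ : 0 ≤ (δ : ℝ) := δ.2
  have hdeg : ∀ u : ℕ, (0 : ℝ) < degBefore g (t * m) (m * u) + δ := fun u => by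
    have : (1 : ℝ) ≤ degBefore g (t * m) (m * u) := by exact_mod_cast one_le_degBefore _ _ _
    linarith
  have hle1 : (protocolLaw (paGraph m t g) k α
      {ω | ∃ v, colourAt (paGraph m t g) ω.1 ω.2 (n + 1) v = .red}).toReal ≤ 1 :=
    measureReal_le_one
  set core := (Finset.univ : Finset (Fin t)).filter (fun u : Fin t => (u : ℕ) < C) with hcoreDef
  set outer := (Finset.univ : Finset (Fin t)).filter (fun u : Fin t => ¬ (u : ℕ) < C) with houterDef
  set A₁ : ℝ := if DegOk δ M g then 0 else 1 with hA₁
  set A₂ : ℝ := ∑ u ∈ core, (K + δ) * (1 / (degBefore g (t * m) (m * u) + δ : ℝ)) with hA₂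
  set A₃ : ℝ := ∑ v ∈ outer, ∑ s ∈ Finset.range (3 * (2 * n + 1) + 1),
      if DegOk δ M g then ((leaflessTuples g s 3 v).card : ℝ) else 0 with hA₃
  set A₄ : ℝ := ∑ u ∈ core, ∑ s ∈ Finset.range (2 * n + 1 + 1),
      (2 * s * (k / K)) * if DegOk δ M g then ((leaflessTuples g s 1 u).card : ℝ) else 0 with hA₄
  set A₅ : ℝ := 2 * (t * m) * redBound r α n with hA₅
  have hdef : graphBound δ k C M K (redBound r α n) n g = A₁ + A₂ + A₃ + A₄ + A₅ := rfl
  have n1 : 0 ≤ A₁ := by rw [hA₁]; split_ifs <;> norm_num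
  have n2' : ∀ u : Fin t, 0 ≤ (K + δ) * (1 / (degBefore g (t * m) (m * u) + δ : ℝ)) := fun u => by
    have := hdeg u; positivity
  have n2 : 0 ≤ A₂ := Finset.sum_nonneg fun u _ => n2' u
  have n3' : ∀ v : Fin t, 0 ≤ ∑ s ∈ Finset.range (3 * (2 * n + 1) + 1),
      if DegOk δ M g then ((leaflessTuples g s 3 v).card : ℝ) else 0 := fun v =>
    Finset.sum_nonneg fun s _ => by split_ifs <;> positivity
  have n3 : 0 ≤ A₃ := Finset.sum_nonneg fun v _ => n3' v
  have n4 : 0 ≤ A₄ := Finset.sum_nonneg fun v _ => Finset.sum_nonneg fun s _ => by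
    split_ifs <;> positivity
  have n5 : 0 ≤ A₅ := by have := (hx n).1; positivity
  rw [hdef]
  by_cases hok : DegOk δ M g
  swap
  · have : A₁ = 1 := by rw [hA₁, if_neg hok]
    linarith
  by_cases hlow : ∃ u ∈ core, (degBefore g (t * m) (m * u) : ℝ) < K
  · obtain ⟨u, hu, hlt⟩ := hlow
    have h1 : 1 ≤ (K + δ) * (1 / (degBefore g (t * m) (m * u) + δ : ℝ)) := by
      rw [mul_one_div, le_div_iff₀ (hdeg u)]
      linarith
    have := Finset.single_le_sum (fun u _ => n2' u) hu
    linarith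
  push Not at hlow
  by_cases htan : ∃ v ∈ outer, 2 < (tangledAt (paGraph m t g) (2 * n + 1) v).card
  · obtain ⟨v, hv, hlt⟩ := htan
    have h1 : (1 : ℝ) ≤ ∑ s ∈ Finset.range (3 * (2 * n + 1) + 1),
        if DegOk δ M g then ((leaflessTuples g s 3 v).card : ℝ) else 0 := by
      simp only [if_pos hok]
      exact_mod_cast exists_leaflessTuple_of_card_tangledAt g hlt
    have := Finset.single_le_sum (fun v _ => n3' v) hv
    linarith
  push Not at htan
  have hmain := protocolLaw_red_le (G := paGraph m t g) hr (α := α) (k := k) (n := n) hx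
    (fun v => hodd _ (le_degree_paGraph g v)) (core := core) (fun v hv => htan v (by
      simpa [houterDef, hcoreDef] using hv))
  have hsum : ∑ u ∈ core, ((tangledAt (paGraph m t g) (2 * n + 1) u).card : ℝ) *
      ((k : ℝ) / ((paGraph m t g).degree u : ℝ)) ≤ A₄ := by
    refine Finset.sum_le_sum fun u hu => ?_
    have hD : K ≤ (paGraph m t g).degree u :=
      (hlow u hu).trans (by exact_mod_cast degBefore_le_degree hm g u)
    simp only [if_pos hok]
    exact card_tangledAt_mul_le g hK hD
  have h0 : 0 ≤ 2 * (Fintype.card (Fin (t * m)) : ℝ) * redBound r α n +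
      ∑ u ∈ core, ((tangledAt (paGraph m t g) (2 * n + 1) u).card : ℝ) *
      ((k : ℝ) / ((paGraph m t g).degree u : ℝ)) :=
    add_nonneg (mul_nonneg (by positivity) (hx n).1) (Finset.sum_nonneg fun u _ =>
      mul_nonneg (Nat.cast_nonneg _) (div_nonneg (Nat.cast_nonneg _) (Nat.cast_nonneg _)))
  have h1 := ENNReal.toReal_mono ENNReal.ofReal_ne_top hmain
  rw [ENNReal.toReal_ofReal h0, Fintype.card_fin] at h1
  refine h1.trans ?_
  push_cast
  linarith

end Quenched

/-! ### Averaging the conditional bound over the random graph. -/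

section Averaged

variable {δ : ℝ≥0} {m t : ℕ}

open Classical in
lemma avg_graphBound_le (hm : 0 < m) {k n C p : ℕ} {K x : ℝ} (hC : 1 ≤ C) (hK : 0 < K) :
    avg δ (t * m) (graphBound δ k C (2 * (1 + δ + p) * Real.exp 2) K x n) ≤
      ((t * m : ℕ) : ℝ) ^ 2 * Real.exp (-2 * p) +
      C * ((K + δ) * ((C : ℝ) / t) ^ (1 / (2 * (2 + δ)) : ℝ)) +
      (∑ s ∈ Finset.range (3 * (2 * n + 1) + 1),
        tupleBound m t (2 * (1 + δ + p) * Real.exp 2) s) *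
          ((∑ y : Fin t, 1 / ((y : ℝ) + 1)) * (1 / √C)) +
      C * (∑ s ∈ Finset.range (2 * n + 1 + 1),
        (2 * s * (k / K)) * tupleBound m t (2 * (1 + δ + p) * Real.exp 2) s) +
      2 * (t * m) * x := by
  have hδ : 0 ≤ (δ : ℝ) := δ.2
  set M := 2 * (1 + δ + p) * Real.exp 2 with hMdef
  have hM : 0 ≤ M := by positivity
  set H := ∑ y : Fin t, 1 / ((y : ℝ) + 1) with hH
  have hH0 : 0 ≤ H := Finset.sum_nonneg fun y _ => by positivity
  have hQ : ∀ s, 0 ≤ tupleBound m t M s := fun s => by unfold tupleBound; positivity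
  have hcore : (((Finset.univ : Finset (Fin t)).filter (fun u : Fin t => (u : ℕ) < C)).card : ℝ)
      ≤ C := by
    have : ((Finset.univ : Finset (Fin t)).filter (fun u : Fin t => (u : ℕ) < C)).card ≤
        (Finset.range C).card :=
      Finset.card_le_card_of_injOn (fun u => (u : ℕ)) (fun u hu => by simpa using hu)
        (fun u _ v _ h => Fin.ext h)
    rw [Finset.card_range] at this
    exact_mod_cast this
  unfold graphBound
  rw [avg_add, avg_add, avg_add, avg_add, avg_const, avg_sum, avg_sum, avg_sum]
  refine add_le_add (add_le_add (add_le_add (add_le_add ?_ ?_) ?_) ?_) le_rfl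
  · exact avg_not_degOk_le p
  · have h : ∀ u ∈ (Finset.univ : Finset (Fin t)).filter (fun u : Fin t => (u : ℕ) < C),
        avg δ (t * m) (fun g => (K + δ) * (1 / (degBefore g (t * m) (m * u) + δ : ℝ))) ≤
          (K + δ) * ((C : ℝ) / t) ^ (1 / (2 * (2 + δ)) : ℝ) := by
      intro u hu
      rw [avg_const_mul]
      have hlt : m * (u : ℕ) ≤ t * m := by
        rw [mul_comm t]; exact Nat.mul_le_mul_left m u.isLt.le
      refine mul_le_mul_of_nonneg_left ((avg_inv_degBefore_le hlt).trans ?_) (by positivity)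
      have ht : (0 : ℝ) < t := by
        have := Nat.zero_lt_of_lt u.isLt
        exact_mod_cast this
      refine Real.rpow_le_rpow (by positivity) ?_ (by positivity)
      rw [div_le_div_iff₀ (by positivity) ht]
      have h1 : (u : ℕ) + 1 ≤ C := (Finset.mem_filter.1 hu).2
      have h2 : m * (u : ℕ) + 1 ≤ C * m := by nlinarith
      have h3 : ((m * (u : ℕ) : ℕ) : ℝ) + 1 ≤ C * m := by exact_mod_cast h2
      push_cast at h3 ⊢
      have hC0 : (0 : ℝ) ≤ C := by positivity
      nlinarith
    refine (Finset.sum_le_card_nsmul _ _ _ h).trans ?_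
    rw [nsmul_eq_mul]
    gcongr
  · have h : ∀ v ∈ (Finset.univ : Finset (Fin t)).filter (fun v : Fin t => ¬ (v : ℕ) < C),
        avg δ (t * m) (fun g => ∑ s ∈ Finset.range (3 * (2 * n + 1) + 1),
          if DegOk δ M g then ((leaflessTuples g s 3 v).card : ℝ) else 0) ≤
        (∑ s ∈ Finset.range (3 * (2 * n + 1) + 1), tupleBound m t M s) *
          (1 / ((v : ℝ) + 1) * (1 / √C)) := by
      intro v hv
      rw [avg_sum, Finset.sum_mul]
      refine Finset.sum_le_sum fun s _ => (avg_card_leaflessTuples_le hM hm v).trans ?_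
      rw [← mul_assoc]
      refine mul_le_mul_of_nonneg_left ?_ (hQ s)
      have h1 : (C : ℝ) ≤ (v : ℝ) + 1 := by
        have : C ≤ (v : ℕ) := Nat.not_lt.1 (Finset.mem_filter.1 hv).2
        have : (C : ℝ) ≤ (v : ℕ) := by exact_mod_cast this
        linarith
      -- Of the three factors 1 / √(v + 1), two form a term of the harmonic sum and the third is at
      -- most 1 / √C outside the core.
      rw [pow_succ, div_pow, Real.sq_sqrt (by positivity), one_pow]
      have hC' : (0 : ℝ) < C := by exact_mod_cast hC
      gcongr
    refine (Finset.sum_le_sum h).trans ?_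
    rw [← Finset.mul_sum, ← Finset.sum_mul]
    refine mul_le_mul_of_nonneg_left ?_ (Finset.sum_nonneg fun s _ => hQ s)
    refine mul_le_mul_of_nonneg_right ?_ (by positivity)
    exact Finset.sum_le_sum_of_subset_of_nonneg (Finset.filter_subset _ _) fun y _ _ => by
      positivity
  · have h : ∀ u ∈ (Finset.univ : Finset (Fin t)).filter (fun u : Fin t => (u : ℕ) < C),
        avg δ (t * m) (fun g => ∑ s ∈ Finset.range (2 * n + 1 + 1),
          (2 * s * (k / K)) * if DegOk δ M g then ((leaflessTuples g s 1 u).card : ℝ) else 0) ≤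
        ∑ s ∈ Finset.range (2 * n + 1 + 1), (2 * s * (k / K)) * tupleBound m t M s := by
      intro u _
      rw [avg_sum]
      refine Finset.sum_le_sum fun s _ => ?_
      rw [avg_const_mul]
      refine mul_le_mul_of_nonneg_left ((avg_card_leaflessTuples_le hM hm u).trans ?_)
        (by positivity)
      rw [← mul_assoc, pow_one]
      refine mul_le_of_le_one_right (hQ s) ?_
      rw [div_le_one (by positivity)]
      exact Real.one_le_sqrt.2 (by linarith [(Nat.cast_nonneg (u : ℕ) : (0 : ℝ) ≤ (u : ℕ))])
    refine (Finset.sum_le_card_nsmul _ _ _ h).trans ?_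
    rw [nsmul_eq_mul]
    refine mul_le_mul_of_nonneg_right hcore (Finset.sum_nonneg fun s _ => ?_)
    have := hQ s
    positivity

/-- The probability of an event of the whole experiment is the average of its conditional
probabilities given the graph. -/
lemma experimentLaw_red_eq (m : ℕ) (δ : ℝ≥0) (k : ℕ) (α : unitInterval) (t T : ℕ) :
    experimentLaw m δ k α t {ω | ∃ v, Outcome.colour ω T v = .red} =
      ENNReal.ofReal (avg (δ / m) (t * m) fun g => (protocolLaw (paGraph m t g) k α
        {ω | ∃ v, colourAt (paGraph m t g) ω.1 ω.2 T v = .red}).toReal) := by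
  have hmeas₁ : ∀ g : Attachments (t * m), MeasurableSet
      {ω : (Fin t → Colour) × (ℕ × Fin t → Finset (Fin (t * m) × Bool)) |
        ∃ v, colourAt (paGraph m t g) ω.1 ω.2 T v = .red} := by
    intro g
    have h : Measurable fun ω : (Fin t → Colour) × (ℕ × Fin t → Finset (Fin (t * m) × Bool)) =>
        colourAt (paGraph m t g) ω.1 ω.2 T :=
      measurable_from_prod_countable_right fun c => measurable_colourAt c T
    exact h (MeasurableSet.of_discrete (s := {c : Fin t → Colour | ∃ v, c v = .red}))
  have hmeas : MeasurableSet {ω : Outcome m t | ∃ v, Outcome.colour ω T v = .red} := by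
    refine measurableSet_setOfPred.2 (measurable_from_prod_countable_right fun g => ?_)
    exact measurableSet_setOfPred.1 (hmeas₁ g)
  have : IsMarkovKernel (Kernel.ofFunOfCountable fun g : Attachments (t * m) =>
      protocolLaw (paGraph m t g) k α) :=
    ⟨fun g => inferInstanceAs (IsProbabilityMeasure (protocolLaw (paGraph m t g) k α))⟩
  unfold experimentLaw
  rw [Measure.compProd_apply hmeas, lintegral_fintype, avg,
    ENNReal.ofReal_sum_of_nonneg fun g _ => mul_nonneg ENNReal.toReal_nonneg ENNReal.toReal_nonneg]
  refine Finset.sum_congr rfl fun g _ => ?_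
  rw [PMF.toMeasure_apply_singleton _ _ (measurableSet_singleton g),
    ENNReal.ofReal_mul ENNReal.toReal_nonneg, ENNReal.ofReal_toReal (PMF.apply_ne_top _ _),
    ENNReal.ofReal_toReal (measure_ne_top _ _), mul_comm]
  rfl

lemma experimentLaw_red_le (hm : 0 < m) {r : ℕ} (hr : 2 ≤ r) {α : unitInterval}
    {k n C p : ℕ} {K : ℝ} (hK : 0 < K)
    (hx : ∀ j, 0 ≤ redBound r α j ∧ redBound r α j ≤ 1 / 2)
    (hodd : ∀ D, m ≤ D → ∃ s, r ≤ s ∧ pollSize k D = 2 * s + 1) :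
    experimentLaw m δ k α t {ω | ∃ v, Outcome.colour ω (n + 1) v = .red} ≤
      ENNReal.ofReal (avg (δ / m) (t * m) (graphBound (δ / m) k C
        (2 * (1 + (δ / m : ℝ≥0) + p) * Real.exp 2) K (redBound r α n) n)) := by
  rw [experimentLaw_red_eq]
  exact ENNReal.ofReal_le_ofReal
    (avg_mono fun g => protocolLaw_red_le_graphBound hm hr hK hx hodd g)

end Averaged

/-! ### Persistence of blue, and the smallest poll size. -/

lemma colourAt_blue_of_le {V E : Type} [Fintype V] [DecidableEq V] [Fintype E]
    {G : Multigraph V E} {c : V → Colour} {polls : ℕ × V → Finset (E × Bool)} {T τ : ℕ}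
    (hT : ∀ v, colourAt G c polls T v = .blue) (h : T ≤ τ) (v : V) :
    colourAt G c polls τ v = .blue := by
  induction τ, h using Nat.le_induction generalizing v with
  | base => exact hT v
  | succ τ _ ih => simp [colourAt, ih]

lemma exists_pollSize_eq {m k d : ℕ} (hm : 5 ≤ m) (hk : 5 ≤ k) (hk_odd : Odd k)
    (hd : d = if Odd m then min m k else min (m - 1) k) :
    ∃ r, 2 ≤ r ∧ d = 2 * r + 1 ∧
      ∀ D, m ≤ D → ∃ s, r ≤ s ∧ pollSize k D = 2 * s + 1 := by
  have hdodd : Odd d ∧ 5 ≤ d ∧ d ≤ k ∧ (Odd m → d ≤ m) ∧ (¬ Odd m → d ≤ m - 1) := by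
    split_ifs at hd with h
    · refine ⟨?_, by omega, by omega, fun _ => by omega, fun h' => absurd h h'⟩
      rcases min_choice m k with e | e <;> rw [hd, e] <;> assumption
    · have h' : Odd (m - 1) := by
        obtain ⟨a, ha⟩ := Nat.not_odd_iff_even.1 h
        exact ⟨a - 1, by omega⟩
      have h5 : 5 ≤ m - 1 := by
        obtain ⟨a, ha⟩ := Nat.not_odd_iff_even.1 h
        omega
      refine ⟨?_, by omega, by omega, fun h' => absurd h' h, fun _ => by omega⟩
      rcases min_choice (m - 1) k with e | e <;> rw [hd, e] <;> assumption
  obtain ⟨⟨r, hr⟩, h5, hdk, hdm, hdm'⟩ := hdodd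
  refine ⟨r, by omega, hr, fun D hD => ?_⟩
  have hodd : Odd (pollSize k D) ∧ d ≤ pollSize k D := by
    unfold pollSize
    split_ifs with h1 h2
    · exact ⟨hk_odd, hdk⟩
    · refine ⟨h2, ?_⟩
      by_cases hmo : Odd m
      · exact (hdm hmo).trans hD
      · have := hdm' hmo; omega
    · obtain ⟨a, ha⟩ := Nat.not_odd_iff_even.1 h2
      refine ⟨⟨a - 1, by omega⟩, ?_⟩
      -- Here D is even and D - 1 half-edges are polled. If m is odd then D ≥ m + 1, so nothing is
      -- lost; if m is even, the loss of one is already part of d.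
      by_cases hmo : Odd m
      · have := hdm hmo
        obtain ⟨b, hb⟩ := hmo
        omega
      · have := hdm' hmo; omega
  obtain ⟨⟨s, hs⟩, hds⟩ := hodd
  exact ⟨s, by omega, hs⟩

/-! ### Asymptotics -/

section Asymptotics

lemma sum_inv_le_one_add_log (t : ℕ) : ∑ y : Fin t, 1 / ((y : ℝ) + 1) ≤ 1 + Real.log t := by
  have h := harmonic_le_one_add_log t
  rw [harmonic] at h
  push_cast at h
  rw [Fin.sum_univ_eq_sum_range fun y => 1 / ((y : ℝ) + 1)]
  simpa [one_div] using h

lemma one_le_sum_inv {t : ℕ} (ht : 0 < t) : 1 ≤ ∑ y : Fin t, 1 / ((y : ℝ) + 1) := by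
  have := Finset.single_le_sum (f := fun y : Fin t => 1 / ((y : ℝ) + 1)) (s := Finset.univ)
    (fun y _ => by positivity) (Finset.mem_univ ⟨0, ht⟩)
  simpa using this

lemma tupleBound_le {m t L s : ℕ} {M R : ℝ} (ht : 0 < t) (h1 : 1 ≤ m * (m * M))
    (hR : m * (m * M) * ((L : ℝ) + 1) ^ 2 * (∑ y : Fin t, 1 / ((y : ℝ) + 1)) ≤ R) (hs : s ≤ L) :
    tupleBound m t M s ≤ R ^ L := by
  have hH := one_le_sum_inv ht
  set H := ∑ y : Fin t, 1 / ((y : ℝ) + 1)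
  have hL : (1 : ℝ) ≤ ((L : ℝ) + 1) ^ 2 :=
    one_le_pow₀ (by linarith [(Nat.cast_nonneg L : (0 : ℝ) ≤ L)])
  have hR1 : 1 ≤ R := (one_le_mul_of_one_le_of_one_le
    (one_le_mul_of_one_le_of_one_le h1 hL) hH).trans hR
  have hs' : (s : ℝ) ≤ L := by exact_mod_cast hs
  calc tupleBound m t M s = (m * (m * M) * ((s : ℝ) + 1) ^ 2 * H) ^ s := by
        unfold tupleBound
        rw [pow_mul, ← mul_pow, ← mul_pow, ← mul_assoc]
    _ ≤ R ^ s := by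
        refine pow_le_pow_left₀ (by positivity) (le_trans ?_ hR) s
        gcongr
    _ ≤ R ^ L := pow_le_pow_right₀ hR1 hs

/-- With C of order at most t ^ b and K = t ^ (3b), the exponent of t is 4b - (1 - b) c. The choice
c = 10 b makes it 10 b² - 6 b, negative for small b. -/
lemma truncated_term_le {δ C t y b c : ℝ} (hδ : 0 ≤ δ) (hC : 0 ≤ C) (hy : 0 ≤ y) (hb0 : 0 ≤ b)
    (hb1 : b ≤ 1 / 40) (hc0 : 0 ≤ c) (hc1 : c ≤ 1) (hcb : c = 10 * b) (hty : t = Real.exp y)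
    (hC2 : C ≤ 2 * Real.exp (b * y)) :
    C * ((Real.exp (3 * b * y) + δ) * (C / t) ^ c) ≤ 4 * (1 + δ) * Real.exp (-(b / 4 * y)) := by
  have ht : 0 ≤ t := hty ▸ (Real.exp_pos y).le
  have h1 : Real.exp (3 * b * y) + δ ≤ (1 + δ) * Real.exp (3 * b * y) := by
    have : 1 ≤ Real.exp (3 * b * y) := Real.one_le_exp (by positivity)
    nlinarith
  have h2 : (C / t) ^ c ≤ 2 * Real.exp ((b - 1) * y * c) := by
    calc (C / t) ^ c ≤ (2 * Real.exp ((b - 1) * y)) ^ c := by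
          refine Real.rpow_le_rpow (by positivity) ?_ hc0
          rw [hty, div_le_iff₀ (Real.exp_pos _), mul_assoc, ← Real.exp_add]
          calc _ ≤ _ := hC2
            _ = _ := by ring_nf
      _ = 2 ^ c * Real.exp ((b - 1) * y * c) := by
          rw [Real.mul_rpow (by norm_num) (Real.exp_pos _).le, ← Real.exp_mul]
      _ ≤ 2 * Real.exp ((b - 1) * y * c) := by
          gcongr
          calc (2 : ℝ) ^ c ≤ 2 ^ (1 : ℝ) :=
                Real.rpow_le_rpow_of_exponent_le (by norm_num) (hc1)
            _ = 2 := Real.rpow_one 2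
  calc C * ((Real.exp (3 * b * y) + δ) * (C / t) ^ c)
      ≤ (2 * Real.exp (b * y)) *
          (((1 + δ) * Real.exp (3 * b * y)) * (2 * Real.exp ((b - 1) * y * c))) := by
        gcongr
    _ = 4 * (1 + δ) * (Real.exp (b * y) * Real.exp (3 * b * y) * Real.exp ((b - 1) * y * c)) := by
        ring
    _ ≤ _ := by
        rw [← Real.exp_add, ← Real.exp_add]
        refine mul_le_mul_of_nonneg_left (Real.exp_le_exp.2 ?_) (by positivity)
        have hbb : b * b * y ≤ b * (1 / 40) * y := by gcongr
        have hby : 0 ≤ b * y := by positivity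
        calc b * y + 3 * b * y + (b - 1) * y * c = 10 * (b * b * y) - 6 * (b * y) := by
              rw [hcb]; ring
          _ ≤ -(b / 4 * y) := by linarith

/-- The factor 1 / √C ≤ t ^ (-b/2) outweighs the subgraph count, at most t ^ (b/4). -/
lemma leafless_term_le {L : ℕ} {R H C b y : ℝ} {Q : ℕ → ℝ} (hQ : ∀ s ≤ L, Q s ≤ R ^ L)
    (hR : 1 ≤ R) (hLR : (L : ℝ) + 1 ≤ R) (hH0 : 0 ≤ H) (hHR : H ≤ R)
    (hC1 : Real.exp (b * y) ≤ C) (hRL : R ^ (L + 2) ≤ Real.exp (b / 4 * y)) :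
    (∑ s ∈ Finset.range (L + 1), Q s) * (H * (1 / √C)) ≤ 1 * Real.exp (-(b / 4 * y)) := by
  have h1 : ∑ s ∈ Finset.range (L + 1), Q s ≤ ((L : ℝ) + 1) * R ^ L := by
    refine (Finset.sum_le_card_nsmul _ _ (R ^ L) fun s hs =>
      hQ s (Nat.lt_succ_iff.1 (Finset.mem_range.1 hs))).trans (le_of_eq ?_)
    simp
  have h2 : 1 / √C ≤ Real.exp (-(b / 2 * y)) := by
    rw [Real.exp_neg, ← one_div]
    apply one_div_le_one_div_of_le (Real.exp_pos _)
    apply Real.le_sqrt_of_sq_le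
    rw [← Real.exp_nat_mul]
    refine le_trans (le_of_eq ?_) hC1
    congr 1
    push_cast
    ring
  calc _ ≤ (R * R ^ L) * (R * Real.exp (-(b / 2 * y))) := by
        refine mul_le_mul (h1.trans ?_) ?_ (by positivity) (by positivity)
        · gcongr
        · gcongr
    _ = R ^ (L + 2) * Real.exp (-(b / 2 * y)) := by ring
    _ ≤ Real.exp (b / 4 * y) * Real.exp (-(b / 2 * y)) := by gcongr
    _ = _ := by rw [← Real.exp_add, one_mul]; congr 1; ring

/-- The ratio of core size to core degree, of order at most t ^ (-2b), outweighs the count t ^ (b/4)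
of tangled half-edges. -/
lemma conflict_term_le {n L k : ℕ} {R C b y : ℝ} {Q : ℕ → ℝ} (hQ0 : ∀ s, 0 ≤ Q s)
    (hQ : ∀ s ≤ L, Q s ≤ R ^ L) (hnL : 2 * n + 1 ≤ L) (hnR : 3 * (2 * (n : ℝ) + 1) + 1 ≤ R)
    (hb : 0 ≤ b) (hy : 0 ≤ y) (hC2 : C ≤ 2 * Real.exp (b * y))
    (hRL : R ^ (L + 2) ≤ Real.exp (b / 4 * y)) :
    C * (∑ s ∈ Finset.range (2 * n + 1 + 1), (2 * s * (k / Real.exp (3 * b * y))) * Q s) ≤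
      2 * k * Real.exp (-(b / 4 * y)) := by
  have hR : 0 ≤ R := by linarith [(Nat.cast_nonneg n : (0 : ℝ) ≤ n)]
  have h1 : ∑ s ∈ Finset.range (2 * n + 1 + 1), (2 * s * (k / Real.exp (3 * b * y))) * Q s ≤
      (R * R * (k / Real.exp (3 * b * y))) * R ^ L := by
    have h2 : ∀ s ∈ Finset.range (2 * n + 1 + 1), (2 * s * (k / Real.exp (3 * b * y))) * Q s ≤
        (2 * (2 * n + 1) * (k / Real.exp (3 * b * y))) * R ^ L := by
      intro s hs
      have hs1 : s ≤ 2 * n + 1 := Nat.lt_succ_iff.1 (Finset.mem_range.1 hs)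
      have hs2 : (s : ℝ) ≤ 2 * n + 1 := by exact_mod_cast hs1
      refine mul_le_mul ?_ (hQ s (hs1.trans hnL)) (hQ0 s) (by positivity)
      gcongr
    refine (Finset.sum_le_card_nsmul _ _ _ h2).trans ?_
    rw [Finset.card_range, nsmul_eq_mul]
    push_cast
    have hn0 : (0 : ℝ) ≤ n := by positivity
    have h3 : (2 * (n : ℝ) + 1 + 1) * (2 * (2 * n + 1)) ≤ R * R := by
      refine mul_le_mul ?_ ?_ (by positivity) (by positivity) <;> linarith
    calc _ = ((2 * (n : ℝ) + 1 + 1) * (2 * (2 * n + 1))) *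
          ((k / Real.exp (3 * b * y)) * R ^ L) := by ring
      _ ≤ (R * R) * ((k / Real.exp (3 * b * y)) * R ^ L) := by gcongr
      _ = _ := by ring
  have h0 : 0 ≤ ∑ s ∈ Finset.range (2 * n + 1 + 1), (2 * s * (k / Real.exp (3 * b * y))) * Q s :=
    Finset.sum_nonneg fun s _ => mul_nonneg (by positivity) (hQ0 s)
  calc _ ≤ (2 * Real.exp (b * y)) * ((R * R * (k / Real.exp (3 * b * y))) * R ^ L) := by gcongr
    _ = 2 * k * (R ^ (L + 2) * (Real.exp (b * y) * (Real.exp (3 * b * y))⁻¹)) := by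
        rw [div_eq_mul_inv]; ring
    _ ≤ 2 * k * (Real.exp (b / 4 * y) * (Real.exp (b * y) * (Real.exp (3 * b * y))⁻¹)) := by gcongr
    _ = 2 * k * Real.exp (b / 4 * y + (b * y + -(3 * b * y))) := by
        rw [Real.exp_add, Real.exp_add, Real.exp_neg]
    _ ≤ _ := by
        refine mul_le_mul_of_nonneg_left (Real.exp_le_exp.2 ?_) (by positivity)
        have hby : 0 ≤ b * y := by positivity
        linarith

lemma heavy_term_le {t m p : ℕ} {y b : ℝ} (hb : b ≤ 1) (hy : 0 ≤ y) (hty : (t : ℝ) = Real.exp y)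
    (hp : 2 * y ≤ p) :
    ((t * m : ℕ) : ℝ) ^ 2 * Real.exp (-2 * p) ≤ m ^ 2 * Real.exp (-(b * y)) := by
  have hby : b * y ≤ y := mul_le_of_le_one_left hy hb
  push_cast
  rw [hty, mul_pow, ← Real.exp_nat_mul, mul_comm (Real.exp _), mul_assoc, ← Real.exp_add]
  refine mul_le_mul_of_nonneg_left (Real.exp_le_exp.2 ?_) (by positivity)
  push_cast
  linarith

lemma red_term_le {t m : ℕ} {y b x : ℝ} (hb : b ≤ 1) (hy : 0 ≤ y) (hty : (t : ℝ) = Real.exp y)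
    (hx : x ≤ Real.exp (-2 * y)) :
    2 * ((t : ℝ) * m) * x ≤ 2 * m * Real.exp (-(b * y)) := by
  have hby : b * y ≤ y := mul_le_of_le_one_left hy hb
  calc 2 * ((t : ℝ) * m) * x ≤ 2 * (t * m) * Real.exp (-2 * y) := by gcongr
    _ = 2 * m * Real.exp (y + -2 * y) := by rw [hty, Real.exp_add]; ring
    _ ≤ 2 * m * Real.exp (-(b * y)) := by
        refine mul_le_mul_of_nonneg_left (Real.exp_le_exp.2 ?_) (by positivity)
        linarith

/-- The bound for the probability of a red vertex is polynomially small in `t = exp y`. -/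
lemma avg_graphBound_le_exp {δ : ℝ≥0} {m t k n : ℕ} (hm : 0 < m) {y A b x : ℝ}
    (hy : 1 ≤ y) (hty : (t : ℝ) = Real.exp y) (hb : b = 1 / (2 * (2 + δ)) / 10)
    (hn : (n : ℝ) ≤ A * Real.log y) (hx : x ≤ Real.exp (-2 * y))
    (E1 : 6 * (A * Real.log y) + 4 ≤ y)
    (E2 : m * (m * (2 * (2 + δ + 2 * y) * Real.exp 2)) ≤ y ^ 2)
    (E3 : 1 + y ≤ y ^ 2)
    (E4 : (6 * (A * Real.log y) + 5) * (6 * Real.log y) ≤ b / 4 * y) :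
    avg δ (t * m) (graphBound δ k ⌈Real.exp (b * y)⌉₊
        (2 * (1 + δ + (⌈2 * y⌉₊ : ℕ)) * Real.exp 2) (Real.exp (3 * b * y)) x n) ≤
      ((m : ℝ) ^ 2 + 4 * (1 + δ) + 1 + 2 * k + 2 * m) * Real.exp (-(b / 4 * y)) := by
  have hδ : 0 ≤ (δ : ℝ) := δ.2
  have hm1 : (1 : ℝ) ≤ m := by exact_mod_cast hm
  have hy0 : 0 < y := by linarith
  have ht0 : 0 < t := by
    have := Real.exp_pos y
    rw [← hty] at this
    exact_mod_cast this
  set c : ℝ := 1 / (2 * (2 + δ)) with hc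
  have hc0 : 0 < c := by positivity
  have hc1 : c ≤ 1 / 4 := by
    rw [hc]
    apply one_div_le_one_div_of_le <;> linarith
  have hb0 : 0 < b := by rw [hb]; positivity
  have hb1 : b ≤ 1 / 40 := by rw [hb]; linarith
  have hb4 : b / 4 ≤ 1 := by linarith
  have hby : 0 < b * y := by positivity
  -- Moments of order 2 log t make exp(-2p) at most t⁻⁴, against the t² from the union bound over
  -- times and vertices.
  set p := ⌈2 * y⌉₊
  have hp1 : 2 * y ≤ p := Nat.le_ceil _
  have hp2 : (p : ℝ) ≤ 2 * y + 1 := (Nat.ceil_lt_add_one (by positivity)).le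
  set C := ⌈Real.exp (b * y)⌉₊
  have hC1 : Real.exp (b * y) ≤ C := Nat.le_ceil _
  have hC2 : (C : ℝ) ≤ 2 * Real.exp (b * y) := by
    have h1 := (Nat.ceil_lt_add_one (Real.exp_pos (b * y)).le).le
    have h2 := Real.one_le_exp hby.le
    linarith
  have hC0 : 1 ≤ C := Nat.one_le_ceil_iff.2 (Real.exp_pos _)
  set K := Real.exp (3 * b * y)
  have hK : 0 < K := Real.exp_pos _
  set M := 2 * (1 + (δ : ℝ) + (p : ℕ)) * Real.exp 2
  set H := ∑ y : Fin t, 1 / ((y : ℝ) + 1)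
  have hH1 : 1 ≤ H := one_le_sum_inv ht0
  have hH2 : H ≤ y ^ 2 := by
    have := sum_inv_le_one_add_log t
    rw [hty, Real.log_exp] at this
    linarith
  -- The largest subgraph in use: three witnesses of 2n + 1 edges each.
  set L := 3 * (2 * n + 1)
  have hL : (L : ℝ) + 1 ≤ y := by
    simp only [L]; push_cast; linarith
  have hM1 : 1 ≤ m * (m * M) := by
    have h2 : 1 ≤ Real.exp 2 := Real.one_le_exp (by norm_num)
    have h3 : 1 ≤ M := one_le_mul_of_one_le_of_one_le
      (by linarith [(Nat.cast_nonneg p : (0 : ℝ) ≤ p)]) h2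
    exact one_le_mul_of_one_le_of_one_le hm1 (one_le_mul_of_one_le_of_one_le hm1 h3)
  have hM2 : m * (m * M) ≤ y ^ 2 := by
    refine le_trans ?_ E2
    have h : 2 * (1 + (δ : ℝ) + p) ≤ 2 * (2 + δ + 2 * y) := by linarith
    simp only [M]
    gcongr
  -- Each of the three factors, the constant with M, (L + 1)² and the harmonic sum, is at most y².
  set R := y ^ 6 with hRdef
  have hR : m * (m * M) * ((L : ℝ) + 1) ^ 2 * H ≤ R := by
    calc _ ≤ y ^ 2 * y ^ 2 * y ^ 2 := by gcongr
      _ = R := by ring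
  have hR1 : 1 ≤ R := one_le_pow₀ hy
  have hQ : ∀ s ≤ L, tupleBound m t M s ≤ R ^ L := fun s hs => tupleBound_le ht0 hM1 hR hs
  have hyR : y ^ 2 ≤ R := pow_le_pow_right₀ hy (by norm_num)
  -- Since L is of order log y, the left side is exp(O(log² y)), which is subpolynomial in t = exp
  -- y.
  have hRL : R ^ (L + 2) ≤ Real.exp (b / 4 * y) := by
    rw [hRdef, ← pow_mul, ← Real.exp_log (pow_pos hy0 _), Real.exp_le_exp, Real.log_pow]
    refine le_trans ?_ E4
    have hlog : 0 ≤ Real.log y := Real.log_nonneg hy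
    have h5 : ((6 * (L + 2) : ℕ) : ℝ) ≤ (6 * (A * Real.log y) + 5) * 6 := by
      simp only [L]; push_cast; linarith
    calc _ ≤ (6 * (A * Real.log y) + 5) * 6 * Real.log y := by gcongr
      _ = _ := by ring
  have hLR : ((L : ℝ) + 1) ≤ R := (hL.trans (le_self_pow₀ hy (by norm_num)))
  have T1 := heavy_term_le (m := m) hb4 hy0.le hty hp1
  have hQ0 : ∀ s, 0 ≤ tupleBound m t M s := fun s => by unfold tupleBound; positivity
  have T2 := truncated_term_le hδ (Nat.cast_nonneg C) hy0.le hb0.le hb1 hc0.le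
    (hc1.trans (by norm_num)) (by rw [hb]; ring) hty hC2
  have T3 := leafless_term_le hQ hR1 hLR (by linarith) (hH2.trans hyR) hC1 hRL
  have hnR : 3 * (2 * (n : ℝ) + 1) + 1 ≤ R := by
    refine le_trans (le_of_eq ?_) hLR
    simp only [L]; push_cast; ring
  have T4 := conflict_term_le (k := k) hQ0 hQ (show 2 * n + 1 ≤ L by omega) hnR hb0.le hy0.le
    hC2 hRL
  have T5 := red_term_le (m := m) hb4 hy0.le hty hx
  refine (avg_graphBound_le hm hC0 hK).trans ?_
  linarith

lemma eventually_growth (A b : ℝ) (hb : 0 < b) (a₁ a₂ : ℝ) :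
    ∀ᶠ y : ℝ in atTop, 1 ≤ y ∧ 6 * (A * Real.log y) + 4 ≤ y ∧ a₁ + a₂ * y ≤ y ^ 2 ∧ 1 + y ≤ y ^ 2 ∧
      (6 * (A * Real.log y) + 5) * (6 * Real.log y) ≤ b / 4 * y := by
  have hlog : Real.log =o[atTop] (id : ℝ → ℝ) := Real.isLittleO_log_id_atTop
  have hlog2 : (fun y => Real.log y ^ 2) =o[atTop] (id : ℝ → ℝ) := Real.isLittleO_pow_log_id_atTop
  have hconst : (fun _ : ℝ => (4 : ℝ)) =o[atTop] (id : ℝ → ℝ) :=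
    Asymptotics.isLittleO_const_id_atTop _
  have h1 : (fun y => 6 * (A * Real.log y) + 4) =o[atTop] (id : ℝ → ℝ) :=
    ((hlog.const_mul_left A).const_mul_left 6).add hconst
  have h4 : (fun y => (6 * (A * Real.log y) + 5) * (6 * Real.log y)) =o[atTop] (id : ℝ → ℝ) := by
    have : (fun y => (6 * (A * Real.log y) + 5) * (6 * Real.log y)) =
        fun y => (36 * A) * Real.log y ^ 2 + 30 * Real.log y := by
      funext y; ring
    rw [this]
    exact (hlog2.const_mul_left _).add (hlog.const_mul_left _)
  have e1 := h1.bound (show (0 : ℝ) < 1 by norm_num)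
  have e4 := h4.bound (show (0 : ℝ) < b / 4 by positivity)
  filter_upwards [e1, e4, eventually_ge_atTop 2, eventually_ge_atTop (|a₁| + |a₂|)]
    with y e1 e4 hy ha
  have hy0 : 0 ≤ y := by linarith
  simp only [id, Real.norm_eq_abs, abs_of_nonneg hy0] at e1 e4
  refine ⟨by linarith, ?_, ?_, by nlinarith, ?_⟩
  · linarith [(abs_le.1 e1).2]
  · have h5 := le_abs_self a₁
    have h6 := le_abs_self a₂
    have h7 := abs_nonneg a₁
    nlinarith
  · linarith [(abs_le.1 e4).2]

/-- The last time step before the time in the theorem. -/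
lemma eventually_time {r : ℕ} (hr : 2 ≤ r) {ε : ℝ} (hε : 0 < ε) (h : ℕ) :
    ∀ᶠ t : ℕ in atTop, ∃ n : ℕ,
      ⌈(1 + ε) / Real.logb (2 * r + 1 : ℕ) r *
        Real.logb (2 * r + 1 : ℕ) (Real.logb (2 * r + 1 : ℕ) t)⌉₊ = n + 1 ∧
      (n : ℝ) ≤ (1 + ε) / Real.log r * Real.log (Real.log t) ∧
      h ≤ n ∧ 2 * Real.log t ≤ (r : ℝ) ^ (n - h) := by
  have hr1 : (2 : ℝ) ≤ r := by exact_mod_cast hr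
  set D : ℝ := ((2 * r + 1 : ℕ) : ℝ) with hD
  have hD5 : 5 ≤ D := by rw [hD]; push_cast; linarith
  have hlr : 0 < Real.log r := Real.log_pos (by linarith)
  have hlD : 1 ≤ Real.log D := by
    rw [Real.le_log_iff_exp_le (by linarith)]
    linarith [Real.exp_one_lt_d9]
  have hylog : Tendsto (fun t : ℕ => Real.log t) atTop atTop :=
    Real.tendsto_log_atTop.comp tendsto_natCast_atTop_atTop
  have hpow : ∀ᶠ y : ℝ in atTop, 2 * (r : ℝ) ^ (h + 1) * Real.log D ^ (1 + ε) ≤ y ^ ε :=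
    (tendsto_rpow_atTop hε).eventually_ge_atTop _
  filter_upwards [hylog.eventually hpow, hylog.eventually_gt_atTop (Real.log D),
    hylog.eventually_ge_atTop 1] with t hp hgt hy1
  set y := Real.log t
  have hy0 : 0 < y := by linarith
  set Y := y / Real.log D with hY
  have hY1 : 1 < Y := by rw [hY, one_lt_div (by linarith)]; exact hgt
  have hYy : Y ≤ y := div_le_self hy0.le hlD
  have hlogY : 0 < Real.log Y := Real.log_pos hY1
  set τ := (1 + ε) / Real.logb D r * Real.logb D (Real.logb D t)
  -- The outer base d cancels; the inner one survives only in Y = log t / log d.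
  have hτ : τ = (1 + ε) / Real.log r * Real.log Y := by
    simp only [τ, Real.logb]
    change (1 + ε) / (Real.log r / Real.log D) * (Real.log Y / Real.log D) = _
    field_simp
  have hτ0 : 0 < τ := by rw [hτ]; positivity
  obtain ⟨n, hn⟩ := Nat.exists_eq_succ_of_ne_zero (Nat.ceil_pos.2 hτ0).ne'
  have hnτ : (n : ℝ) < τ := by
    have := Nat.ceil_lt_add_one hτ0.le
    rw [hn] at this
    push_cast at this
    linarith
  have hτn : τ ≤ n + 1 := by
    have := Nat.le_ceil τ
    rw [hn] at this
    push_cast at this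
    exact this
  -- Here r ^ (n + 1) ≥ r ^ τ = Y ^ (1 + ε). The surplus y ^ ε absorbs the constants, including the
  -- h initial steps before the doubly exponential decay sets in.
  have hbig : 2 * y * (r : ℝ) ^ (h + 1) ≤ (r : ℝ) ^ (n + 1) := by
    have h1 : Y ^ (1 + ε) ≤ (r : ℝ) ^ (n + 1) := by
      rw [Real.rpow_def_of_pos (by linarith), ← Real.rpow_natCast,
        Real.rpow_def_of_pos (by linarith), Real.exp_le_exp]
      push_cast
      have h2 : Real.log Y * (1 + ε) = Real.log r * τ := by rw [hτ]; field_simp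
      rw [h2]
      gcongr
    refine le_trans ?_ h1
    rw [hY, Real.div_rpow hy0.le (by linarith), le_div_iff₀ (by positivity),
      Real.rpow_add hy0, Real.rpow_one]
    calc _ = y * (2 * (r : ℝ) ^ (h + 1) * Real.log D ^ (1 + ε)) := by ring
      _ ≤ _ := by gcongr
  have hhn : h ≤ n := by
    by_contra! hlt
    have h1 : (r : ℝ) ^ (n + 1) ≤ (r : ℝ) ^ (h + 1) := pow_le_pow_right₀ (by linarith) (by omega)
    have h2 : 0 < (r : ℝ) ^ (h + 1) := by positivity
    nlinarith
  refine ⟨n, hn, ?_, hhn, ?_⟩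
  · refine hnτ.le.trans ?_
    rw [hτ]
    have : Real.log Y ≤ Real.log y := Real.log_le_log (by linarith) hYy
    gcongr
  · have h2 : 0 < (r : ℝ) ^ (h + 1) := by positivity
    have h3 : (r : ℝ) ^ (n + 1) = (r : ℝ) ^ (n - h) * (r : ℝ) ^ (h + 1) := by
      rw [← pow_add]; congr 1; omega
    rw [h3] at hbig
    exact le_of_mul_le_mul_right hbig h2

end Asymptotics

end PrefAttach

/-! ### The theorem. -/

theorem theorem1 (m k d : ℕ) (hm : 5 ≤ m) (hk : 5 ≤ k) (hk_odd : Odd k)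
    (hd : d = if Odd m then min m k else min (m - 1) k)
    (δ : ℝ≥0) (αstar α : unitInterval)
    (hαstar : IsLeast {x : unitInterval | 0 < x ∧
      (binomial (d - 1) x).real {j : ℕ | ((d : ℝ) - 1) / 2 ≤ (j : ℝ)} = (x : ℝ)} αstar)
    (hα : α < αstar) (ε : ℝ) (hε : 0 < ε) :
    Tendsto
      (fun t : ℕ => PrefAttach.experimentLaw m δ k α t
        {ω | ∀ τ : ℕ,
          (1 + ε) / Real.logb d (((d : ℝ) - 1) / 2) * Real.logb d (Real.logb d t) ≤ (τ : ℝ) →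
            ∀ v : Fin t, PrefAttach.Outcome.colour ω τ v = PrefAttach.Colour.blue})
      atTop (𝓝 1) := by
  open PrefAttach in
  obtain ⟨r, hr, rfl, hodd⟩ := exists_pollSize_eq hm hk hk_odd hd
  have hhalf : (((2 * r + 1 : ℕ) : ℝ) - 1) / 2 = r := by push_cast; ring
  simp only [hhalf, Nat.cast_le, Nat.add_sub_cancel, binomial_real_Ici] at hαstar ⊢
  have hmin : ∀ x : ℝ, 0 < x → x ≤ 1 → binTail (2 * r) r x = x → (αstar : ℝ) ≤ x := by
    intro x h0 h1 hx
    exact hαstar.2 (show (⟨x, h0.le, h1⟩ : unitInterval) ∈ _ from ⟨h0, hx⟩)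
  have hαa : (α : ℝ) < αstar := hα
  have hx : ∀ j, 0 ≤ redBound r α j ∧ redBound r α j ≤ 1 / 2 := fun j => by
    have := redBound_mem hr αstar.2.2 hmin α.2.1 hαa j
    exact ⟨this.1, this.2.le.trans (fixedPoint_le_half hr hmin)⟩
  obtain ⟨h, hh⟩ := exists_redBound_le_exp hr αstar.2.2 hmin α.2.1 hαa
  set δ' : ℝ≥0 := δ / m
  -- One tenth of the exponent in the negative moment bound, taken with the parameter δ / m of the
  -- graph before contraction.
  set b : ℝ := 1 / (2 * (2 + δ')) / 10 with hb
  have hb0 : 0 < b := by positivity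
  set A : ℝ := (1 + ε) / Real.log r
  set Q : ℝ := (m : ℝ) ^ 2 + 4 * (1 + δ') + 1 + 2 * k + 2 * m
  have hylog : Tendsto (fun t : ℕ => Real.log t) atTop atTop :=
    Real.tendsto_log_atTop.comp tendsto_natCast_atTop_atTop
  have hlim : Tendsto (fun t : ℕ => ENNReal.ofReal (Q * Real.exp (-(b / 4 * Real.log t)))) atTop
      (𝓝 0) := by
    rw [← ENNReal.ofReal_zero]
    refine ENNReal.tendsto_ofReal ?_
    rw [← mul_zero Q]
    refine Tendsto.const_mul Q (Real.tendsto_exp_neg_atTop_nhds_zero.comp ?_)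
    exact hylog.const_mul_atTop (by positivity)
  have hlow : Tendsto (fun t : ℕ => 1 - ENNReal.ofReal (Q * Real.exp (-(b / 4 * Real.log t)))) atTop
      (𝓝 1) := by
    have := ENNReal.Tendsto.sub (tendsto_const_nhds (x := (1 : ℝ≥0∞))) hlim (Or.inl (by simp))
    simpa using this
  refine tendsto_of_tendsto_of_tendsto_of_le_of_le' hlow tendsto_const_nhds ?_
    (Eventually.of_forall fun t => prob_le_one)
  filter_upwards [eventually_time hr hε h, eventually_gt_atTop 0, hylog.eventually
    (eventually_growth A b hb0 (m * (m * (2 * (2 + δ') * Real.exp 2)))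
      (m * (m * (2 * 2 * Real.exp 2))))] with t ⟨n, hT, hnA, hhn, hrn⟩ ht0 ⟨hy, E1, E2, E3, E4⟩
  have hred : redBound r α n ≤ Real.exp (-2 * Real.log t) := by
    have h1 := hh (n - h)
    rw [Nat.add_sub_cancel' hhn] at h1
    refine h1.trans (Real.exp_le_exp.2 ?_)
    linarith
  have hbound := (experimentLaw_red_le (δ := δ) (t := t) (k := k) (n := n)
    (C := ⌈Real.exp (b * Real.log t)⌉₊) (p := ⌈2 * Real.log t⌉₊)
    (show 0 < m by omega) hr (α := α) (Real.exp_pos (3 * b * Real.log t)) hx hodd).trans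
    (ENNReal.ofReal_le_ofReal (avg_graphBound_le_exp (A := A) (show 0 < m by omega) hy
      (Real.exp_log (by exact_mod_cast ht0)).symm hb hnA hred E1 (le_trans (le_of_eq (by ring)) E2)
      E3 E4))
  -- The event of the theorem and the event of a red vertex at time n + 1 together cover everything.
  -- Subadditivity then gives the lower bound without measurability of the former.
  rw [tsub_le_iff_right]
  refine le_trans ?_ (add_le_add le_rfl hbound)
  refine le_trans (le_of_eq measure_univ.symm) (le_trans (measure_mono ?_) (measure_union_le _ _))
  intro ω _
  by_cases hω : ∃ v, Outcome.colour ω (n + 1) v = .red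
  · exact Or.inr hω
  · refine Or.inl fun τ hτ v => ?_
    have hle : n + 1 ≤ τ := by rw [← hT]; exact Nat.ceil_le.2 hτ
    refine colourAt_blue_of_le (T := n + 1) (fun v => ?_) hle v
    by_contra hne
    refine hω ⟨v, ?_⟩
    unfold Outcome.colour
    cases hc : colourAt (paGraph m t ω.1) ω.2.1 ω.2.2 (n + 1) v
    · rfl
    · exact absurd hc hne
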